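/- Let $(\nu_t)_{t\ge 0}$ be a measure-valued solution of Smoluchowski's coagulation equation with constant kernel $K=2$ and finite, nonzero initial data $\nu_0$. That is, each $\nu_t$ is a positive Radon measure on $(0,\infty)$; $\nu_0((0,\infty))<\infty$; $t\mapsto\nu_t(B)$ is measurable for every compact $B\subset(0,\infty)$; $\int_0^t\nu_\tau((0,\infty))^2\,d\tau<\infty$ for all $t>0$; and, for every $t\ge 0$ and every continuous function $f$ on $(0,\infty)$ with finite limits at $0$ and at $\infty$, $f$ is $\nu_t$-integrable and $$\int_{(0,\infty)} f\,d\nu_t=\int_{(0,\infty)} f\,d\nu_0+\int_0^t\int_{(0,\infty)}\int_{(0,\infty)}\bigl[f(x+y)-f(x)-f(y)\bigr]\,\nu_\tau(dx)\,\nu_\tau(dy)\,d\tau .$$ Let $F(t,x)=\nu_t((0,x])/\nu_t((0,\infty))$. A positive function $L$ on $(0,\infty)$ is called slowly varying at infinity if $L(cx)/L(x)\to1$ as $x\to\infty$ for every $c>0$, and $\sim$ means that the quotient tends to $1$. 1. Suppose there are a function $\lambda(t)\to\infty$ as $t\to\infty$ and a probability distribution function $F_*$ on $[0,\infty)$ that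 is nontrivial, i.e. $F_*(x)<1$ for some $x>0$, such that $\lim_{t\to\infty}F(t,\lambda(t)x)=F_*(x)$ at all points of continuity $x>0$ of $F_*$. Then there exist $\rho\in(0,1]$ and a function $L$ slowly varying at infinity such that $$\int_{(0,x]} y\,\nu_0(dy)\sim x^{1-\rho}L(x)\quad\text{as }x\to\infty. \qquad (*)$$ 2. Conversely, suppose $(*)$ holds for some $\rho\in(0,1]$ and some $L$ slowly varying at infinity. Then there is a strictly increasing function $\lambda:(0,\infty)\to(0,\infty)$ with $\lambda(t)\to\infty$ as $t\to\infty$ such that $$\lim_{t\to\infty}F(t,\lambda(t)x)=F_\rho(x)\quad\text{for all }x\in(0,\infty),\qquad F_\rho(x)=\sum_{k=1}^\infty\frac{(-1)^{k+1}x^{\rho k}}{\Gamma(1+\rho k)}.$$ Here $F_\rho$ is the Mittag-Leffler distribution function: it is the distribution function on $(0,\infty)$ of a probability measure on $(0,\infty)$ whose Laplace transform is $\int_{(0,\infty)} e^{-sx}\,F_\rho(dx)=1/(1+s^\rho)$, $s\ge0$. -/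

import Mathlib

open MeasureTheory ProbabilityTheory Filter Set Topology

noncomputable section

/-- A positive Radon measure on `E = (0,∞)`, encoded as a measure on `ℝ` that does not charge
`(-∞,0]` and is finite on every compact subset of `(0,∞)`. -/
structure IsRadonOnPos (ν : Measure ℝ) : Prop where
  null_nonpos : ν (Iic 0) = 0
  finite_compact : ∀ B : Set ℝ, IsCompact B → B ⊆ Ioi 0 → ν B < ⊤

/-- `f` restricts to a continuous function on the compactified half line `[0,∞]`: it is continuous
on `(0,∞)` and has finite limits at `0` and at `∞`. Values of `f` off `(0,∞)` play no role. -/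
def IsContOnEbar (f : ℝ → ℝ) : Prop :=
  ContinuousOn f (Ioi 0) ∧ (∃ a : ℝ, Tendsto f (𝓝[>] 0) (𝓝 a)) ∧ ∃ b : ℝ, Tendsto f atTop (𝓝 b)

/-- The weak coagulation operator
`⟨f, L(ν)⟩ = (1/2) ∫∫ [f(x+y) - f(x) - f(y)] K(x,y) ν(dx) ν(dy)`. -/
def coagPairing (K : ℝ → ℝ → ℝ) (ν : Measure ℝ) (f : ℝ → ℝ) : ℝ :=
  (1 / 2 : ℝ) * ∫ x in Ioi 0, ∫ y in Ioi 0, (f (x + y) - f x - f y) * K x y ∂ν ∂ν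

/-- `t ↦ ν t`, `t ∈ [0,∞)`, is a measure-valued solution of Smoluchowski's coagulation equation
with the constant kernel `K = 2`. Only the values `ν t` with `t ≥ 0` matter. -/
structure IsSmoluchowskiSolution (ν : ℝ → Measure ℝ) : Prop where
  radon : ∀ t, 0 ≤ t → IsRadonOnPos (ν t)
  /-- the initial number of clusters is finite -/
  finite_init : ν 0 (Ioi 0) < ⊤
  /-- `t ↦ ν t B` is (Lebesgue) measurable on `[0,∞)` for each compact `B ⊆ (0,∞)` -/
  measurable_compact : ∀ B : Set ℝ, IsCompact B → B ⊆ Ioi 0 →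
    AEMeasurable (fun t => ν t B) (volume.restrict (Ici 0))
  /-- the square of the total number is locally integrable in time -/
  sq_integrable : ∀ t, 0 < t → ∫⁻ τ in Ioc 0 t, (ν τ (Ioi 0)) ^ 2 < ⊤
  /-- the weak form of the equation, for all test functions in `C([0,∞])`; that the left-hand
  pairing is finite is part of the requirement -/
  weak : ∀ f : ℝ → ℝ, IsContOnEbar f → ∀ t, 0 ≤ t →
    IntegrableOn f (Ioi 0) (ν t) ∧
    ∫ x in Ioi 0, f x ∂(ν t) =
      ∫ x in Ioi 0, f x ∂(ν 0) + ∫ τ in (0 : ℝ)..t, coagPairing (fun _ _ => 2) (ν τ) f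

/-- The normalized size distribution `F(t,x) = ν_t((0,x]) / ν_t((0,∞))`. -/
def sizeDist (ν : ℝ → Measure ℝ) (t x : ℝ) : ℝ :=
  (ν t (Ioc 0 x)).toReal / (ν t (Ioi 0)).toReal

/-- `L`, a positive function on `(0,∞)`, is slowly varying at infinity. -/
def IsSlowlyVarying (L : ℝ → ℝ) : Prop :=
  (∀ x, 0 < x → 0 < L x) ∧
    ∀ c, 0 < c → Tendsto (fun x => L (c * x) / L x) atTop (𝓝 1)

/-- `∫₀ˣ y ν₀(dy) ∼ x^{1-ρ} L(x)` as `x → ∞`, i.e. the quotient tends to `1`. -/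
def MassAsymptotics (ν₀ : Measure ℝ) (ρ : ℝ) (L : ℝ → ℝ) : Prop :=
  Tendsto (fun x : ℝ => (∫ y in Ioc 0 x, y ∂ν₀) / (x ^ (1 - ρ) * L x)) atTop (𝓝 1)

/-- The Mittag-Leffler distribution function
`F_ρ(x) = ∑_{k ≥ 1} (-1)^{k+1} x^{ρ k} / Γ(1 + ρ k)`, `x > 0` (the series is indexed from `0`). -/
def mittagLefflerDist (ρ x : ℝ) : ℝ :=
  ∑' k : ℕ, (-1 : ℝ) ^ k * x ^ (ρ * ((k : ℝ) + 1)) / Real.Gamma (1 + ρ * ((k : ℝ) + 1))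

end

/-!
With the constant kernel `K = 2`, testing the equation with `1` and with `1 - e^{-sx}` gives the
Riccati equation `g' = -g²` both for the total number `η t` and for the Bernstein transform
`φ t s = ∫ (1 - e^{-sx}) ν t (dx)`, so that
`η t = η 0 / (1 + t η 0)` and `φ t s = φ 0 s / (1 + t φ 0 s)`
(`IsSmoluchowskiSolution.number_eq`, `IsSmoluchowskiSolution.bernsteinTransform_eq`). The Laplace
transform of the normalized size distribution is `1 - φ / η`; as `t η t → 1`, its scaling limits are
those of `t * φ 0 (s / lam t)`, and everything reduces to the behaviour of `h = φ 0` at `0`.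

If the size distributions converge, then `t * h (s / lam t)` has a strictly increasing continuous
limit `Φ s`. Inserting the times `t = Φ 1 / h (1 / x)` turns this into the convergence of
`h (c / x) / h (1 / x)`, whose limit is multiplicative in `c` and so a power `c ^ ρ`
(`tendsto_quotient_of_tendsto_scaled`, `exists_eq_rpow_of_tendsto`); `0 < ρ` by strict
monotonicity and `ρ ≤ 1` by concavity of `h`. Concavity also gives
`u * h' u / h u → ρ` (`tendsto_massTransform_div`), and since `h'` is the Laplace transform of
`y ν₀(dy)`, a Tauberian argument yields the mass asymptotics (`tendsto_massDist_div`).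

Conversely, `h (1 / x) = x⁻¹ ∫ k(z) M(x z) dz` for the mass distribution function `M` and an explicit
positive kernel `k`, so regular variation of `M` passes to `h` by dominated convergence
(`isRegularlyVaryingAtZero_of_massAsymptotics`). With `h (1 / lam t) = η t` the Laplace transforms
of the size distributions converge to `1 / (1 + s ^ ρ)`.

Both Tauberian steps are instances of `tendsto_of_tendsto_laplace`: monotone functions whose Laplace
transforms converge to that of a continuous function, for `s > 1`, converge pointwise. The limit
function is not assumed to be monotone. It can thus be applied to the Mittag-Leffler series, whose
Laplace transform for `s > 1` is computed term by term, and monotonicity of the series is a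
consequence of the convergence; this also produces the Mittag-Leffler measure.
-/

/-! ### The Riccati equation and the explicit solution -/

/-- As long as `g ^ 2` is integrable, the integral equation can be differentiated; with
`w = g * (1 + g 0 * t) - g 0` one has `w' = -g * w`, so `w ^ 2` decreases from `0`. -/
theorem riccati_of_intervalIntegrable {g : ℝ → ℝ} (hg : ∀ t, 0 ≤ t → 0 ≤ g t)
    (h : ∀ t, 0 ≤ t → g t = g 0 - ∫ τ in (0 : ℝ)..t, g τ ^ 2) {T : ℝ} (hT : 0 ≤ T)
    (hint : IntervalIntegrable (fun τ => g τ ^ 2) volume 0 T) :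
    g T = g 0 / (1 + g 0 * T) := by
  have hcont : ContinuousOn g (Icc 0 T) := by
    have h1 : ContinuousOn (fun t => g 0 - ∫ τ in (0 : ℝ)..t, g τ ^ 2) (Icc 0 T) := by
      refine continuousOn_const.sub ?_
      have := intervalIntegral.continuousOn_primitive_interval (μ := volume)
        (f := fun τ => g τ ^ 2) (a := 0) (b := T)
        (by rw [uIcc_of_le hT]
            exact (intervalIntegrable_iff_integrableOn_Icc_of_le hT).1 hint)
      rwa [uIcc_of_le hT] at this
    exact h1.congr fun t ht => h t ht.1
  have hderiv : ∀ t ∈ Ioo 0 T, HasDerivAt g (-(g t) ^ 2) t := by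
    intro t ht
    have hct : ContinuousAt (fun τ => g τ ^ 2) t :=
      ((hcont t ⟨ht.1.le, ht.2.le⟩).continuousAt (Icc_mem_nhds ht.1 ht.2)).pow 2
    have hmeas : StronglyMeasurableAtFilter (fun τ => g τ ^ 2) (𝓝 t) volume :=
      ContinuousOn.stronglyMeasurableAtFilter isOpen_Ioo
        ((hcont.mono Ioo_subset_Icc_self).pow 2) t ht
    have h1 := intervalIntegral.integral_hasDerivAt_right
      (hint.mono_set (by
        rw [uIcc_of_le hT, uIcc_of_le ht.1.le]; exact Icc_subset_Icc_right ht.2.le)) hmeas hct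
    have h2 := h1.const_sub (g 0)
    refine h2.congr_of_eventuallyEq ?_
    filter_upwards [Ioi_mem_nhds ht.1] with u hu using h u (le_of_lt hu)
  set w : ℝ → ℝ := fun t => g t * (1 + g 0 * t) - g 0 with hw
  have hwd : ∀ t ∈ Ioo 0 T, HasDerivAt (fun t => w t ^ 2) (-2 * g t * w t ^ 2) t := by
    intro t ht
    have h1 : HasDerivAt (fun t => 1 + g 0 * t) (g 0) t := by
      simpa using ((hasDerivAt_id t).const_mul (g 0)).const_add 1
    have h2 := (((hderiv t ht).mul h1).sub_const (g 0)).pow 2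
    refine h2.congr_deriv ?_
    simp only [hw, Pi.mul_apply]
    push_cast
    ring
  have hanti : AntitoneOn (fun t => w t ^ 2) (Icc 0 T) := by
    refine antitoneOn_of_deriv_nonpos (convex_Icc 0 T) ?_ ?_ ?_
    · exact ((hcont.mul (by fun_prop)).sub continuousOn_const).pow 2
    · rw [interior_Icc]
      exact fun t ht => (hwd t ht).differentiableAt.differentiableWithinAt
    · rw [interior_Icc]
      intro t ht
      rw [(hwd t ht).deriv]
      have := mul_nonneg (hg t ht.1.le) (sq_nonneg (w t))
      linarith
  have h0 : w T ^ 2 ≤ 0 := by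
    have := hanti ⟨le_rfl, hT⟩ ⟨hT, le_rfl⟩ hT
    simpa [hw] using this
  have hwT : w T = 0 := pow_eq_zero_iff two_ne_zero |>.1 (le_antisymm h0 (sq_nonneg _))
  have hpos : 0 < 1 + g 0 * T := by
    have := mul_nonneg (hg 0 le_rfl) hT
    linarith
  rw [eq_div_iff hpos.ne']
  simp only [hw] at hwT
  linarith

/-- The integral form of `g' = -g ^ 2` without any measurability hypothesis: the times `t` at which
`g ^ 2` is integrable on `[0, t]` form an interval, there `g` is the Riccati solution, and off
this interval the (junk) integral vanishes and `g` is constant. So `g` is measurable and bounded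
after all, and the interval is all of `[0, ∞)`. -/
theorem eq_div_of_riccati {g : ℝ → ℝ} (hg : ∀ t, 0 ≤ t → 0 ≤ g t)
    (h : ∀ t, 0 ≤ t → g t = g 0 - ∫ τ in (0 : ℝ)..t, g τ ^ 2) {T : ℝ} (hT : 0 ≤ T) :
    g T = g 0 / (1 + g 0 * T) := by
  classical
  set A : Set ℝ := {t | 0 ≤ t ∧ IntervalIntegrable (fun τ => g τ ^ 2) volume 0 t} with hA
  have hAo : A.OrdConnected := by
    refine ⟨fun x hx y hy z hz => ⟨hx.1.trans hz.1, ?_⟩⟩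
    refine hy.2.mono_set ?_
    rw [uIcc_of_le (hx.1.trans hz.1), uIcc_of_le hy.1]
    exact Icc_subset_Icc_right hz.2
  have hAm : MeasurableSet A := hAo.measurableSet
  have hval : ∀ t ∈ Icc 0 T, g t = A.piecewise (fun t => g 0 / (1 + g 0 * t)) (fun _ => g 0) t := by
    intro t ht
    by_cases htA : t ∈ A
    · rw [piecewise_eq_of_mem _ _ _ htA]
      exact riccati_of_intervalIntegrable hg h ht.1 htA.2
    · rw [piecewise_eq_of_notMem _ _ _ htA, h t ht.1, intervalIntegral.integral_undef]
      · simp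
      · exact fun hh => htA ⟨ht.1, hh⟩
  have hmeas : Measurable (A.piecewise (fun t => g 0 / (1 + g 0 * t)) (fun _ => g 0)) :=
    Measurable.piecewise hAm (by fun_prop) measurable_const
  refine riccati_of_intervalIntegrable hg h hT ?_
  rw [intervalIntegrable_iff_integrableOn_Icc_of_le hT]
  have hmeas' : AEStronglyMeasurable (fun τ => g τ ^ 2) (volume.restrict (Icc 0 T)) := by
    refine ((hmeas.pow_const 2).aestronglyMeasurable (μ := volume.restrict (Icc 0 T))).congr ?_
    filter_upwards [ae_restrict_mem measurableSet_Icc] with t ht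
    rw [hval t ht]
  refine Integrable.of_bound hmeas' (g 0 ^ 2) ?_
  filter_upwards [ae_restrict_mem measurableSet_Icc] with t ht
  have h0 := hg 0 le_rfl
  have h1 : g t ≤ g 0 := by
    rw [hval t ht]
    by_cases htA : t ∈ A
    · rw [piecewise_eq_of_mem _ _ _ htA]
      exact div_le_self h0 (by nlinarith [mul_nonneg h0 ht.1])
    · rw [piecewise_eq_of_notMem _ _ _ htA]
  rw [Real.norm_of_nonneg (sq_nonneg _)]
  exact pow_le_pow_left₀ (hg t ht.1) h1 2

/-- The Bernstein transform `s ↦ ∫_{(0,∞)} (1 - e^{-sy}) m(dy)` of a measure. -/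
noncomputable def bernsteinTransform (m : Measure ℝ) (s : ℝ) : ℝ :=
  ∫ y in Ioi 0, (1 - Real.exp (-(s * y))) ∂m

namespace IsSmoluchowskiSolution

variable {ν : ℝ → Measure ℝ}

theorem isContOnEbar_one : IsContOnEbar (fun _ => 1) :=
  ⟨continuousOn_const, ⟨1, tendsto_const_nhds⟩, ⟨1, tendsto_const_nhds⟩⟩

theorem isContOnEbar_one_sub_exp {s : ℝ} (hs : 0 < s) :
    IsContOnEbar (fun y => 1 - Real.exp (-(s * y))) := by
  have hc : Continuous (fun y => 1 - Real.exp (-(s * y))) := by fun_prop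
  refine ⟨hc.continuousOn, ⟨_, (hc.tendsto 0).mono_left nhdsWithin_le_nhds⟩, 1 - 0, ?_⟩
  refine tendsto_const_nhds.sub (Real.tendsto_exp_neg_atTop_nhds_zero.comp ?_)
  exact tendsto_id.const_mul_atTop hs

theorem measure_Ioi_lt_top (hν : IsSmoluchowskiSolution ν) {t : ℝ} (ht : 0 ≤ t) :
    ν t (Ioi 0) < ⊤ := by
  have h := (hν.weak _ isContOnEbar_one t ht).1
  rw [IntegrableOn, integrable_const_iff] at h
  rcases h with h | h
  · exact absurd h one_ne_zero
  · simpa using h.measure_univ_lt_top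

theorem number_eq (hν : IsSmoluchowskiSolution ν) {t : ℝ} (ht : 0 ≤ t) :
    (ν t).real (Ioi 0) = (ν 0).real (Ioi 0) / (1 + (ν 0).real (Ioi 0) * t) := by
  refine eq_div_of_riccati (g := fun t => (ν t).real (Ioi 0))
    (fun _ _ => measureReal_nonneg) (fun t ht => ?_) ht
  have h := (hν.weak _ isContOnEbar_one t ht).2
  simp only [setIntegral_const, smul_eq_mul, mul_one, coagPairing] at h
  rw [h, sub_eq_add_neg ((ν 0).real (Ioi 0)), ← intervalIntegral.integral_neg]
  congr 1
  refine intervalIntegral.integral_congr fun τ _ => ?_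
  ring

theorem bernsteinTransform_eq (hν : IsSmoluchowskiSolution ν) {s : ℝ} (hs : 0 < s)
    {t : ℝ} (ht : 0 ≤ t) :
    bernsteinTransform (ν t) s =
      bernsteinTransform (ν 0) s / (1 + bernsteinTransform (ν 0) s * t) := by
  refine eq_div_of_riccati (g := fun t => bernsteinTransform (ν t) s) (fun t _ => ?_)
    (fun t ht => ?_) ht
  · refine setIntegral_nonneg measurableSet_Ioi fun y hy => ?_
    have : Real.exp (-(s * y)) ≤ 1 := Real.exp_le_one_iff.2 (by
      have := mul_pos hs (mem_Ioi.1 hy); linarith)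
    linarith
  · have h := (hν.weak _ (isContOnEbar_one_sub_exp hs) t ht).2
    simp only [bernsteinTransform]
    rw [h, sub_eq_add_neg (∫ y in Ioi 0, (1 - Real.exp (-(s * y))) ∂(ν 0)),
      ← intervalIntegral.integral_neg]
    congr 1
    refine intervalIntegral.integral_congr fun τ _ => ?_
    simp only [coagPairing]
    have : ∀ x y : ℝ, (1 - Real.exp (-(s * (x + y))) - (1 - Real.exp (-(s * x))) -
        (1 - Real.exp (-(s * y)))) * 2 =
        (-2 * (1 - Real.exp (-(s * x)))) * (1 - Real.exp (-(s * y))) := by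
      intro x y
      rw [show -(s * (x + y)) = -(s * x) + -(s * y) by ring, Real.exp_add]
      ring
    simp_rw [this, integral_const_mul, integral_mul_const, integral_const_mul]
    ring

end IsSmoluchowskiSolution

/-! ### A Tauberian theorem for monotone functions -/

theorem integrableOn_exp_mul_comp_exp_mul {G : ℝ → ℝ}
    (hG : IntegrableOn (fun x => Real.exp (-(2 * x)) * G x) (Ioi 0)) {k : ℝ → ℝ}
    (hk : Continuous k) :
    IntegrableOn (fun x => k (Real.exp (-x)) * (Real.exp (-(2 * x)) * G x)) (Ioi 0) := by
  obtain ⟨C, hC⟩ := isCompact_Icc.exists_bound_of_continuousOn (s := Icc (0 : ℝ) 1) hk.continuousOn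
  refine Integrable.bdd_mul (c := C) hG
    (hk.comp (by fun_prop : Continuous fun x : ℝ => Real.exp (-x))).aestronglyMeasurable ?_
  filter_upwards [ae_restrict_mem measurableSet_Ioi] with x hx
  exact hC _ ⟨(Real.exp_pos _).le, Real.exp_le_one_iff.2 (by linarith [mem_Ioi.1 hx])⟩

section
variable {ι : Type*} {l : Filter ι} {G : ι → ℝ → ℝ} {F : ℝ → ℝ}
  (hGi : ∀ᶠ i in l, ∀ s : ℝ, 1 < s → IntegrableOn (fun x => Real.exp (-(s * x)) * G i x) (Ioi 0))
  (hFi : ∀ s : ℝ, 1 < s → IntegrableOn (fun x => Real.exp (-(s * x)) * F x) (Ioi 0))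
  (hlim : ∀ s : ℝ, 1 < s → Tendsto (fun i => ∫ x in Ioi 0, Real.exp (-(s * x)) * G i x) l
    (𝓝 (∫ x in Ioi 0, Real.exp (-(s * x)) * F x)))
include hGi hFi hlim

theorem tendsto_integral_polynomial_exp (p : Polynomial ℝ) :
    Tendsto (fun i => ∫ x in Ioi 0, p.eval (Real.exp (-x)) * (Real.exp (-(2 * x)) * G i x)) l
    (𝓝 (∫ x in Ioi 0, p.eval (Real.exp (-x)) * (Real.exp (-(2 * x)) * F x))) := by
  induction p using Polynomial.induction_on' with
  | add p q hp hq =>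
    have hF2 := hFi 2 (by norm_num)
    simp only [Polynomial.eval_add, add_mul]
    rw [integral_add (integrableOn_exp_mul_comp_exp_mul hF2 p.continuous)
      (integrableOn_exp_mul_comp_exp_mul hF2 q.continuous)]
    refine (hp.add hq).congr' ?_
    filter_upwards [hGi] with i hi
    exact (integral_add (integrableOn_exp_mul_comp_exp_mul (hi 2 (by norm_num)) p.continuous)
      (integrableOn_exp_mul_comp_exp_mul (hi 2 (by norm_num)) q.continuous)).symm
  | monomial n a =>
    have key : ∀ H : ℝ → ℝ,
        ∫ x in Ioi 0, (Polynomial.monomial n a).eval (Real.exp (-x)) *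
          (Real.exp (-(2 * x)) * H x) =
        a * ∫ x in Ioi 0, Real.exp (-((n + 2 : ℝ) * x)) * H x := by
      intro H
      rw [← integral_const_mul]
      congr 1
      ext x
      rw [Polynomial.eval_monomial, ← Real.exp_nat_mul,
        show -((n + 2 : ℝ) * x) = n * (-x) + -(2 * x) by ring, Real.exp_add]
      ring
    simp only [key]
    exact (hlim _ (by have : (0 : ℝ) ≤ n := n.cast_nonneg
                      linarith)).const_mul a

theorem tendsto_integral_continuous_exp (hG0 : ∀ᶠ i in l, ∀ x, 0 < x → 0 ≤ G i x)
    {k : ℝ → ℝ} (hk : Continuous k) :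
    Tendsto (fun i => ∫ x in Ioi 0, k (Real.exp (-x)) * (Real.exp (-(2 * x)) * G i x)) l
    (𝓝 (∫ x in Ioi 0, k (Real.exp (-x)) * (Real.exp (-(2 * x)) * F x))) := by
  have hF2 := hFi 2 (by norm_num)
  set C : ℝ := ∫ x in Ioi 0, |Real.exp (-(2 * x)) * F x| with hC
  set C' : ℝ := ∫ x in Ioi 0, Real.exp (-(2 * x)) * F x with hC'
  have hCC : C' ≤ C := by
    refine integral_mono hF2 hF2.abs fun x => le_abs_self _
  have hC0 : 0 ≤ C := integral_nonneg fun x => abs_nonneg _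
  -- the error made by replacing `k` with a polynomial that is uniformly close to it
  have err : ∀ (H : ℝ → ℝ) (p : Polynomial ℝ) (δ : ℝ),
      IntegrableOn (fun x => Real.exp (-(2 * x)) * H x) (Ioi 0) →
      (∀ z ∈ Icc (0 : ℝ) 1, |p.eval z - k z| < δ) →
      |(∫ x in Ioi 0, p.eval (Real.exp (-x)) * (Real.exp (-(2 * x)) * H x)) -
        ∫ x in Ioi 0, k (Real.exp (-x)) * (Real.exp (-(2 * x)) * H x)| ≤
      δ * ∫ x in Ioi 0, |Real.exp (-(2 * x)) * H x| := by
    intro H p δ hH hp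
    rw [← integral_sub (integrableOn_exp_mul_comp_exp_mul hH p.continuous)
      (integrableOn_exp_mul_comp_exp_mul hH hk), ← integral_const_mul]
    refine (abs_integral_le_integral_abs).trans ?_
    refine setIntegral_mono_on ?_ (hH.abs.const_mul δ) measurableSet_Ioi ?_
    · exact ((integrableOn_exp_mul_comp_exp_mul hH p.continuous).sub
        (integrableOn_exp_mul_comp_exp_mul hH hk)).abs
    · intro x hx
      rw [← sub_mul, abs_mul]
      exact mul_le_mul_of_nonneg_right (hp _ ⟨(Real.exp_pos _).le,
        Real.exp_le_one_iff.2 (by linarith [mem_Ioi.1 hx])⟩).le (abs_nonneg _)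
  rw [Metric.tendsto_nhds]
  intro ε hε
  set δ : ℝ := ε / (4 * (C + 1)) with hδ
  have hδ0 : 0 < δ := by positivity
  have hδC : δ * (C + 1) = ε / 4 := by rw [hδ]; field_simp
  obtain ⟨p, hp⟩ := exists_polynomial_near_of_continuousOn 0 1 k hk.continuousOn δ hδ0
  have h1 := (Metric.tendsto_nhds.1 (tendsto_integral_polynomial_exp hGi hFi hlim p)) (ε / 4)
    (by positivity)
  have h2 := (hlim 2 (by norm_num)).eventually_lt_const
    (show C' < C + 1 by linarith)
  filter_upwards [h1, h2, hGi, hG0] with i hi1 hi2 hi3 hi4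
  have e1 := err (G i) p δ (hi3 2 (by norm_num)) hp
  have e2 := err F p δ hF2 hp
  have e3 : ∫ x in Ioi 0, |Real.exp (-(2 * x)) * G i x| =
      ∫ x in Ioi 0, Real.exp (-(2 * x)) * G i x :=
    setIntegral_congr_fun measurableSet_Ioi fun x hx =>
      abs_of_nonneg (mul_nonneg (Real.exp_pos _).le (hi4 x hx))
  rw [e3] at e1
  rw [Real.dist_eq] at hi1 ⊢
  have e4 : δ * ∫ x in Ioi 0, Real.exp (-(2 * x)) * G i x ≤ ε / 4 := by
    rw [← hδC]; exact mul_le_mul_of_nonneg_left hi2.le hδ0.le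
  have e5 : δ * C ≤ ε / 4 := by
    rw [← hδC]; exact mul_le_mul_of_nonneg_left (by linarith) hδ0.le
  rw [abs_le] at e1 e2
  rw [abs_lt] at hi1 ⊢
  constructor <;> linarith [e1.1, e1.2, e2.1, e2.2, hi1.1, hi1.2]

/-- A Tauberian theorem: if the Laplace transforms of nonnegative monotone functions `G i` converge
to that of a continuous `F` (of no prescribed sign), then `G i` converges to `F` pointwise.
By Weierstrass approximation in the variable `z = e^{-x}`, integrals against test functions
converge; a bump just to the right (left) of `x` bounds `G i x` from above (below). -/
theorem tendsto_of_tendsto_laplace (hG : ∀ᶠ i in l, MonotoneOn (G i) (Ioi 0))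
    (hG0 : ∀ᶠ i in l, ∀ x, 0 < x → 0 ≤ G i x) (hF : ContinuousOn F (Ioi 0))
    {x : ℝ} (hx : 0 < x) :
    Tendsto (fun i => G i x) l (𝓝 (F x)) := by
  have hF2 := hFi 2 (by norm_num)
  -- The weight `e^{-2y} k(e^{-y})`, where `k(z) = max 0 ((z-e^{-v})(e^{-u}-z))`, is supported
  -- in `[u, v]`.
  set k : ℝ → ℝ → ℝ → ℝ := fun u v z =>
    max 0 ((z - Real.exp (-v)) * (Real.exp (-u) - z)) with hk
  have hkc : ∀ u v, Continuous (k u v) := fun u v => by simp only [hk]; fun_prop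
  have hk0 : ∀ u v z, 0 ≤ k u v z := fun u v z => le_max_left _ _
  have hksupp : ∀ u v y, u < v → y ∉ Icc u v → k u v (Real.exp (-y)) = 0 := by
    intro u v y huv hy
    refine max_eq_left ?_
    rw [mem_Icc, not_and_or, not_le, not_le] at hy
    rcases hy with hy | hy
    · refine mul_nonpos_of_nonneg_of_nonpos (sub_nonneg.2 (Real.exp_le_exp.2 ?_))
        (sub_nonpos.2 (Real.exp_le_exp.2 ?_)) <;> linarith
    · refine mul_nonpos_of_nonpos_of_nonneg (sub_nonpos.2 (Real.exp_le_exp.2 ?_))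
        (sub_nonneg.2 (Real.exp_le_exp.2 ?_)) <;> linarith
  have hone : IntegrableOn (fun x : ℝ => Real.exp (-(2 * x)) * (1 : ℝ)) (Ioi 0) := by
    simpa using integrableOn_exp_mul_Ioi (a := -2) (by norm_num) 0
  have hKint := fun u v => integrableOn_exp_mul_comp_exp_mul hone (hkc u v)
  set J : ℝ → ℝ → ℝ := fun u v =>
    ∫ y in Ioi 0, k u v (Real.exp (-y)) * (Real.exp (-(2 * y)) * (1 : ℝ)) with hJ
  have hJpos : ∀ u v, 0 < u → u < v → 0 < J u v := by
    intro u v hu huv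
    refine (setIntegral_pos_iff_support_of_nonneg_ae ?_ (hKint u v)).2 ?_
    · exact Eventually.of_forall fun y => mul_nonneg (hk0 _ _ _) (by positivity)
    · have hsub : Ioo u v ⊆ (Function.support fun y =>
          k u v (Real.exp (-y)) * (Real.exp (-(2 * y)) * (1 : ℝ))) ∩ Ioi 0 := by
        intro y hy
        refine ⟨?_, hu.trans hy.1⟩
        have : 0 < k u v (Real.exp (-y)) := by
          refine lt_max_of_lt_right (mul_pos (sub_pos.2 (Real.exp_lt_exp.2 ?_))
            (sub_pos.2 (Real.exp_lt_exp.2 ?_))) <;> linarith [hy.1, hy.2]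
        exact (mul_pos this (by positivity)).ne'
      refine lt_of_lt_of_le ?_ (measure_mono hsub)
      simp [huv]
  -- comparison of a weighted integral with a bound that holds on the support
  have cmp : ∀ (A B : ℝ → ℝ) (u v : ℝ), 0 < u → u < v →
      IntegrableOn (fun x => Real.exp (-(2 * x)) * A x) (Ioi 0) →
      IntegrableOn (fun x => Real.exp (-(2 * x)) * B x) (Ioi 0) →
      (∀ y ∈ Icc u v, A y ≤ B y) →
      ∫ y in Ioi 0, k u v (Real.exp (-y)) * (Real.exp (-(2 * y)) * A y) ≤
        ∫ y in Ioi 0, k u v (Real.exp (-y)) * (Real.exp (-(2 * y)) * B y) := by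
    intro A B u v hu huv hA hB hAB
    refine setIntegral_mono_on (integrableOn_exp_mul_comp_exp_mul hA (hkc u v))
      (integrableOn_exp_mul_comp_exp_mul hB (hkc u v)) measurableSet_Ioi fun y _ => ?_
    by_cases hy : y ∈ Icc u v
    · exact mul_le_mul_of_nonneg_left (mul_le_mul_of_nonneg_left (hAB y hy) (Real.exp_pos _).le)
        (hk0 _ _ _)
    · simp [hksupp u v y huv hy]
  have hconst : ∀ c : ℝ, IntegrableOn (fun x : ℝ => Real.exp (-(2 * x)) * c) (Ioi 0) := by
    intro c
    have := hone.mul_const c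
    simpa [IntegrableOn] using this
  have hJc : ∀ (c u v : ℝ),
      ∫ y in Ioi 0, k u v (Real.exp (-y)) * (Real.exp (-(2 * y)) * c) = c * J u v := by
    intro c u v
    rw [hJ, ← integral_const_mul]
    congr 1
    ext y
    ring
  have hFx : ContinuousAt F x := hF.continuousAt (Ioi_mem_nhds hx)
  rw [tendsto_order]
  constructor
  · intro a ha
    obtain ⟨b, hab, hb⟩ := exists_between ha
    obtain ⟨u, hux, hu⟩ : ∃ u, u < x ∧ ∀ y ∈ Icc u x, 0 < y ∧ b ≤ F y := by
      have h1 : ∀ᶠ y in 𝓝 x, 0 < y ∧ b ≤ F y :=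
        (eventually_gt_nhds hx).and ((hFx.eventually_const_lt hb).mono fun _ => le_of_lt)
      obtain ⟨ε, hε, h2⟩ := Metric.eventually_nhds_iff_ball.1 h1
      refine ⟨x - ε / 2, by linarith, fun y hy => h2 y ?_⟩
      rw [Metric.mem_ball, Real.dist_eq, abs_lt]
      constructor <;> linarith [hy.1, hy.2]
    have hu0 : 0 < u := (hu u ⟨le_rfl, hux.le⟩).1
    have hJp := hJpos u x hu0 hux
    have h1 := tendsto_integral_continuous_exp hGi hFi hlim hG0 (hkc u x)
    have h2 := cmp (fun _ => b) F u x hu0 hux (hconst b) hF2 (fun y hy => (hu y hy).2)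
    rw [hJc] at h2
    have h3 := h1.eventually_const_lt
      (show a * J u x < _ from (mul_lt_mul_of_pos_right hab hJp).trans_le h2)
    filter_upwards [h3, hG, hGi] with i hi hm hgi
    have h4 := cmp (G i) (fun _ => G i x) u x hu0 hux (hgi 2 (by norm_num)) (hconst _)
      (fun y hy => hm (hu0.trans_le hy.1) hx hy.2)
    rw [hJc] at h4
    exact lt_of_mul_lt_mul_right (hi.trans_le h4) hJp.le
  · intro a ha
    obtain ⟨b, hb, hab⟩ := exists_between ha
    obtain ⟨v, hxv, hv⟩ : ∃ v, x < v ∧ ∀ y ∈ Icc x v, F y ≤ b := by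
      have h1 : ∀ᶠ y in 𝓝 x, F y ≤ b := (hFx.eventually_lt_const hb).mono fun _ => le_of_lt
      obtain ⟨ε, hε, h2⟩ := Metric.eventually_nhds_iff_ball.1 h1
      refine ⟨x + ε / 2, by linarith, fun y hy => h2 y ?_⟩
      rw [Metric.mem_ball, Real.dist_eq, abs_lt]
      constructor <;> linarith [hy.1, hy.2]
    have hJp := hJpos x v hx hxv
    have h1 := tendsto_integral_continuous_exp hGi hFi hlim hG0 (hkc x v)
    have h2 := cmp F (fun _ => b) x v hx hxv hF2 (hconst b) hv
    rw [hJc] at h2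
    have h3 := h1.eventually_lt_const
      (show _ < a * J x v from h2.trans_lt (mul_lt_mul_of_pos_right hab hJp))
    filter_upwards [h3, hG, hGi] with i hi hm hgi
    have h4 := cmp (fun _ => G i x) (G i) x v hx hxv (hconst _) (hgi 2 (by norm_num))
      (fun y hy => hm hx (hx.trans_le hy.1) hy.1)
    rw [hJc] at h4
    exact lt_of_mul_lt_mul_right (h4.trans_lt hi) hJp.le

end

/-! ### Integration by parts against distribution functions -/

theorem lintegral_mul_measure_Ioc (ω : Measure ℝ) [SFinite ω] {K : ℝ → ENNReal}
    (hK : Measurable K) :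
    ∫⁻ z in Ioi 0, K z * ω (Ioc 0 z) = ∫⁻ y in Ioi 0, (∫⁻ z in Ioi y, K z) ∂ω := by
  have hm : Measurable fun p : ℝ × ℝ => {p : ℝ × ℝ | p.2 ≤ p.1}.indicator (fun p => K p.1) p :=
    Measurable.indicator (hK.comp measurable_fst) (measurableSet_le measurable_snd measurable_fst)
  have h1 : ∀ z ∈ Ioi (0 : ℝ), K z * ω (Ioc 0 z) =
      ∫⁻ y in Ioi 0, {p : ℝ × ℝ | p.2 ≤ p.1}.indicator (fun p => K p.1) (z, y) ∂ω := by
    intro z _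
    have : (fun y => {p : ℝ × ℝ | p.2 ≤ p.1}.indicator (fun p => K p.1) (z, y)) =
        (Iic z).indicator fun _ => K z := by
      ext y; simp [indicator]
    rw [this, lintegral_indicator measurableSet_Iic, setLIntegral_const,
      Measure.restrict_apply measurableSet_Iic, inter_comm, Ioi_inter_Iic]
  have h2 : ∀ y ∈ Ioi (0 : ℝ), ∫⁻ z in Ioi y, K z =
      ∫⁻ z in Ioi 0, {p : ℝ × ℝ | p.2 ≤ p.1}.indicator (fun p => K p.1) (z, y) := by
    intro y hy
    have : (fun z => {p : ℝ × ℝ | p.2 ≤ p.1}.indicator (fun p => K p.1) (z, y)) =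
        (Ici y).indicator K := by
      ext z; simp [indicator]
    rw [this, lintegral_indicator measurableSet_Ici, Measure.restrict_restrict measurableSet_Ici,
      inter_eq_left.2 (Ici_subset_Ioi.2 hy), restrict_Ioi_eq_restrict_Ici]
  rw [setLIntegral_congr_fun measurableSet_Ioi h1, setLIntegral_congr_fun measurableSet_Ioi h2]
  exact lintegral_lintegral_swap hm.aemeasurable

section
variable {ω : Measure ℝ} [SFinite ω] {K J : ℝ → ℝ}

omit [SFinite ω] in
theorem measurable_measureReal_Ioc (hω : ∀ z, ω (Ioc 0 z) ≠ ⊤) :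
    Measurable fun z => ω.real (Ioc 0 z) :=
  Monotone.measurable fun _ b hab => measureReal_mono (Ioc_subset_Ioc_right hab) (hω b)

theorem lintegral_mul_measureReal_Ioc (hω : ∀ z, ω (Ioc 0 z) ≠ ⊤) (hK : Measurable K)
    (hK0 : ∀ z, 0 < z → 0 ≤ K z)
    (hKJ : ∀ y, 0 < y → IntegrableOn K (Ioi y) ∧ ∫ z in Ioi y, K z = J y) :
    ∫⁻ z in Ioi 0, ENNReal.ofReal (K z * ω.real (Ioc 0 z)) =
      ∫⁻ y in Ioi 0, ENNReal.ofReal (J y) ∂ω := by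
  have h1 : ∀ z ∈ Ioi (0 : ℝ), ENNReal.ofReal (K z * ω.real (Ioc 0 z)) =
      ENNReal.ofReal (K z) * ω (Ioc 0 z) := by
    intro z hz
    rw [ENNReal.ofReal_mul (hK0 z hz), measureReal_def, ENNReal.ofReal_toReal (hω z)]
  have h2 : ∀ y ∈ Ioi (0 : ℝ), ENNReal.ofReal (J y) = ∫⁻ z in Ioi y, ENNReal.ofReal (K z) := by
    intro y hy
    rw [← (hKJ y hy).2, ofReal_integral_eq_lintegral_ofReal (hKJ y hy).1]
    filter_upwards [ae_restrict_mem measurableSet_Ioi] with z hz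
    exact hK0 z (lt_trans (mem_Ioi.1 hy) hz)
  rw [setLIntegral_congr_fun measurableSet_Ioi h1, setLIntegral_congr_fun measurableSet_Ioi h2]
  exact lintegral_mul_measure_Ioc ω hK.ennreal_ofReal

theorem integral_mul_measureReal_Ioc (hω : ∀ z, ω (Ioc 0 z) ≠ ⊤) (hK : Measurable K)
    (hJ : Measurable J) (hK0 : ∀ z, 0 < z → 0 ≤ K z)
    (hKJ : ∀ y, 0 < y → IntegrableOn K (Ioi y) ∧ ∫ z in Ioi y, K z = J y) :
    ∫ z in Ioi 0, K z * ω.real (Ioc 0 z) = ∫ y in Ioi 0, J y ∂ω := by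
  have hJ0 : ∀ y, 0 < y → 0 ≤ J y := fun y hy => by
    rw [← (hKJ y hy).2]
    exact setIntegral_nonneg measurableSet_Ioi fun z hz => hK0 z (hy.trans hz)
  rw [integral_eq_lintegral_of_nonneg_ae _
      (by have := measurable_measureReal_Ioc hω; fun_prop),
    integral_eq_lintegral_of_nonneg_ae _ hJ.aestronglyMeasurable,
    lintegral_mul_measureReal_Ioc hω hK hK0 hKJ]
  · filter_upwards [ae_restrict_mem measurableSet_Ioi] with y hy using hJ0 y hy
  · filter_upwards [ae_restrict_mem measurableSet_Ioi] with z hz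
    exact mul_nonneg (hK0 z hz) measureReal_nonneg

theorem integrableOn_mul_measureReal_Ioc (hω : ∀ z, ω (Ioc 0 z) ≠ ⊤) (hK : Measurable K)
    (hK0 : ∀ z, 0 < z → 0 ≤ K z)
    (hKJ : ∀ y, 0 < y → IntegrableOn K (Ioi y) ∧ ∫ z in Ioi y, K z = J y)
    (hJi : IntegrableOn J (Ioi 0) ω) :
    IntegrableOn (fun z => K z * ω.real (Ioc 0 z)) (Ioi 0) := by
  have hJ0 : ∀ y, 0 < y → 0 ≤ J y := fun y hy => by
    rw [← (hKJ y hy).2]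
    exact setIntegral_nonneg measurableSet_Ioi fun z hz => hK0 z (hy.trans hz)
  refine ⟨(hK.mul (measurable_measureReal_Ioc hω)).aestronglyMeasurable, ?_⟩
  rw [hasFiniteIntegral_iff_ofReal, lintegral_mul_measureReal_Ioc hω hK hK0 hKJ]
  · refine (hasFiniteIntegral_iff_ofReal ?_).1 hJi.2
    filter_upwards [ae_restrict_mem measurableSet_Ioi] with y hy using hJ0 y hy
  · filter_upwards [ae_restrict_mem measurableSet_Ioi] with z hz
    exact mul_nonneg (hK0 z hz) measureReal_nonneg

theorem integral_exp_Ioi_pos {s : ℝ} (hs : 0 < s) (y : ℝ) :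
    IntegrableOn (fun z => Real.exp (-(s * z))) (Ioi y) ∧
      ∫ z in Ioi y, Real.exp (-(s * z)) = Real.exp (-(s * y)) / s := by
  have h1 := integrableOn_exp_mul_Ioi (a := -s) (by linarith) y
  have h2 := integral_exp_mul_Ioi (a := -s) (by linarith) y
  simp only [neg_mul] at h1 h2
  exact ⟨h1, by rw [h2, neg_div_neg_eq]⟩

theorem integral_exp_mul_measureReal_Ioc (hω : ∀ z, ω (Ioc 0 z) ≠ ⊤) {s : ℝ} (hs : 0 < s) :
    ∫ z in Ioi 0, Real.exp (-(s * z)) * ω.real (Ioc 0 z) =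
      (∫ y in Ioi 0, Real.exp (-(s * y)) ∂ω) / s := by
  rw [integral_mul_measureReal_Ioc (J := fun y => Real.exp (-(s * y)) / s) hω (by fun_prop)
    (by fun_prop) (fun z _ => (Real.exp_pos _).le) (fun y _ => integral_exp_Ioi_pos hs y),
    integral_div]

theorem integrableOn_exp_mul_measureReal_Ioc (hω : ∀ z, ω (Ioc 0 z) ≠ ⊤) {s : ℝ} (hs : 0 < s)
    (hi : IntegrableOn (fun y => Real.exp (-(s * y))) (Ioi 0) ω) :
    IntegrableOn (fun z => Real.exp (-(s * z)) * ω.real (Ioc 0 z)) (Ioi 0) :=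
  integrableOn_mul_measureReal_Ioc (J := fun y => Real.exp (-(s * y)) / s) hω (by fun_prop)
    (fun z _ => (Real.exp_pos _).le) (fun y _ => integral_exp_Ioi_pos hs y) (hi.div_const s)

end

/-! ### The Bernstein transform of a finite measure -/

section
variable {m : Measure ℝ} [IsFiniteMeasure m]

theorem integrableOn_exp_neg_mul {s : ℝ} (hs : 0 ≤ s) :
    IntegrableOn (fun y => Real.exp (-(s * y))) (Ioi 0) m := by
  refine Integrable.of_bound (by fun_prop) 1 ?_
  filter_upwards [ae_restrict_mem measurableSet_Ioi] with y hy
  rw [Real.norm_of_nonneg (Real.exp_pos _).le, Real.exp_le_one_iff]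
  have := mul_nonneg hs (mem_Ioi.1 hy).le
  linarith

theorem bernsteinTransform_eq_sub {s : ℝ} (hs : 0 ≤ s) :
    bernsteinTransform m s = m.real (Ioi 0) - ∫ y in Ioi 0, Real.exp (-(s * y)) ∂m := by
  rw [bernsteinTransform, integral_sub (integrable_const _) (integrableOn_exp_neg_mul hs)]
  simp

omit [IsFiniteMeasure m] in
theorem bernsteinTransform_zero : bernsteinTransform m 0 = 0 := by simp [bernsteinTransform]

theorem bernsteinTransform_strictMonoOn (hm : m (Ioi 0) ≠ 0) :
    StrictMonoOn (bernsteinTransform m) (Ici 0) := by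
  intro a ha b hb hab
  rw [bernsteinTransform_eq_sub ha, bernsteinTransform_eq_sub hb]
  have hi := (integrableOn_exp_neg_mul (m := m) (mem_Ici.1 ha)).sub
    (integrableOn_exp_neg_mul (m := m) (mem_Ici.1 hb))
  have hlt : ∀ y : ℝ, 0 < y → Real.exp (-(b * y)) < Real.exp (-(a * y)) := fun y hy =>
    Real.exp_lt_exp.2 (neg_lt_neg (mul_lt_mul_of_pos_right hab hy))
  have : 0 < ∫ y in Ioi 0, (Real.exp (-(a * y)) - Real.exp (-(b * y))) ∂m := by
    refine (setIntegral_pos_iff_support_of_nonneg_ae ?_ hi).2 ?_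
    · filter_upwards [ae_restrict_mem measurableSet_Ioi] with y hy
      exact (sub_pos.2 (hlt y hy)).le
    · refine (pos_iff_ne_zero.2 hm).trans_le (measure_mono fun y hy => ⟨?_, hy⟩)
      exact (sub_pos.2 (hlt y hy)).ne'
  rw [integral_sub (integrableOn_exp_neg_mul ha) (integrableOn_exp_neg_mul hb)] at this
  linarith

theorem bernsteinTransform_pos (hm : m (Ioi 0) ≠ 0) {s : ℝ} (hs : 0 < s) :
    0 < bernsteinTransform m s := by
  have := bernsteinTransform_strictMonoOn hm self_mem_Ici (mem_Ici.2 hs.le) hs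
  rwa [bernsteinTransform_zero] at this

theorem bernsteinTransform_lt (hm : m (Ioi 0) ≠ 0) {s : ℝ} (hs : 0 ≤ s) :
    bernsteinTransform m s < m.real (Ioi 0) := by
  rw [bernsteinTransform_eq_sub hs]
  have : 0 < ∫ y in Ioi 0, Real.exp (-(s * y)) ∂m := by
    refine (setIntegral_pos_iff_support_of_nonneg_ae ?_ (integrableOn_exp_neg_mul hs)).2 ?_
    · exact Eventually.of_forall fun y => (Real.exp_pos _).le
    · exact (pos_iff_ne_zero.2 hm).trans_le
        (measure_mono fun y hy => ⟨(Real.exp_pos _).ne', hy⟩)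
  linarith

theorem bernsteinTransform_continuousOn : ContinuousOn (bernsteinTransform m) (Ici 0) := by
  refine continuousOn_of_dominated (bound := fun _ => 1) ?_ ?_ (integrable_const _) ?_
  · exact fun s _ => by fun_prop
  · intro s hs
    filter_upwards [ae_restrict_mem measurableSet_Ioi] with y hy
    have h1 : Real.exp (-(s * y)) ≤ 1 := Real.exp_le_one_iff.2 (by
      have := mul_nonneg (mem_Ici.1 hs) (mem_Ioi.1 hy).le
      linarith)
    rw [Real.norm_of_nonneg (by linarith)]
    linarith [Real.exp_pos (-(s * y))]
  · exact Eventually.of_forall fun y => by fun_prop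

theorem tendsto_bernsteinTransform_atTop :
    Tendsto (bernsteinTransform m) atTop (𝓝 (m.real (Ioi 0))) := by
  have h : Tendsto (fun s => ∫ y in Ioi 0, (1 - Real.exp (-(s * y))) ∂m) atTop
      (𝓝 (∫ y in Ioi 0, (1 : ℝ) ∂m)) := by
    refine tendsto_integral_filter_of_dominated_convergence (fun _ => 1) ?_ ?_
      (integrable_const _) ?_
    · exact Eventually.of_forall fun s => by fun_prop
    · filter_upwards [eventually_ge_atTop 0] with s hs
      filter_upwards [ae_restrict_mem measurableSet_Ioi] with y hy
      have h1 : Real.exp (-(s * y)) ≤ 1 := Real.exp_le_one_iff.2 (by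
        have := mul_nonneg hs (mem_Ioi.1 hy).le
        linarith)
      rw [Real.norm_of_nonneg (by linarith)]
      linarith [Real.exp_pos (-(s * y))]
    · filter_upwards [ae_restrict_mem measurableSet_Ioi] with y hy
      have h2 : Tendsto (fun s : ℝ => s * y) atTop atTop := tendsto_id.atTop_mul_const hy
      simpa using (Real.tendsto_exp_neg_atTop_nhds_zero.comp h2).const_sub 1
  simp only [setIntegral_const, smul_eq_mul, mul_one] at h
  exact h

/-- The first moment transform `s ↦ ∫_{(0,∞)} y e^{-sy} m(dy)`, the derivative of the Bernstein
transform. -/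
noncomputable def massTransform (m : Measure ℝ) (s : ℝ) : ℝ :=
  ∫ y in Ioi 0, y * Real.exp (-(s * y)) ∂m

theorem integrableOn_mul_exp_neg_mul {s : ℝ} (hs : 0 < s) :
    IntegrableOn (fun y => y * Real.exp (-(s * y))) (Ioi 0) m := by
  refine Integrable.of_bound (by fun_prop) (1 / s) ?_
  filter_upwards [ae_restrict_mem measurableSet_Ioi] with y hy
  have hy := mem_Ioi.1 hy
  rw [Real.norm_of_nonneg (by positivity), Real.exp_neg, ← div_eq_mul_inv,
    div_le_div_iff₀ (Real.exp_pos _) hs]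
  linarith [Real.add_one_le_exp (s * y)]

/-- Concavity of the Bernstein transform: it lies below its tangent at `u`. -/
theorem bernsteinTransform_sub_le {c u : ℝ} (hc : 0 < c) (hu : 0 < u) :
    bernsteinTransform m (c * u) - bernsteinTransform m u ≤ (c - 1) * (u * massTransform m u) := by
  rw [bernsteinTransform_eq_sub (by positivity), bernsteinTransform_eq_sub hu.le]
  have h : ∫ y in Ioi 0, (Real.exp (-(u * y)) - Real.exp (-(c * u * y))) ∂m ≤
      ∫ y in Ioi 0, (c - 1) * u * (y * Real.exp (-(u * y))) ∂m := by
    refine integral_mono ((integrableOn_exp_neg_mul hu.le).sub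
      (integrableOn_exp_neg_mul (by positivity))) ((integrableOn_mul_exp_neg_mul hu).const_mul _) ?_
    intro y
    have h1 := Real.add_one_le_exp (-((c - 1) * u * y))
    have h2 : Real.exp (-(c * u * y)) = Real.exp (-(u * y)) * Real.exp (-((c - 1) * u * y)) := by
      rw [← Real.exp_add]; congr 1; ring
    simp only
    rw [h2]
    nlinarith [Real.exp_pos (-(u * y)), mul_le_mul_of_nonneg_left h1 (Real.exp_pos (-(u * y))).le]
  rw [integral_sub (integrableOn_exp_neg_mul hu.le) (integrableOn_exp_neg_mul (by positivity)),
    integral_const_mul] at h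
  simp only [massTransform]
  linarith

theorem bernsteinTransform_mul_le {c u : ℝ} (hc : 1 ≤ c) (hu : 0 < u) :
    bernsteinTransform m (c * u) ≤ c * bernsteinTransform m u := by
  simp only [bernsteinTransform]
  rw [← integral_const_mul]
  have hi : ∀ s : ℝ, 0 ≤ s → IntegrableOn (fun y => 1 - Real.exp (-(s * y))) (Ioi 0) m :=
    fun s hs => (integrable_const 1).sub (integrableOn_exp_neg_mul hs)
  refine setIntegral_mono_on (hi _ (by positivity)) ((hi _ hu.le).const_mul c) measurableSet_Ioi
    fun y _ => ?_
  -- Bernoulli's inequality for `e^{-cuy} = (e^{-uy})^c`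
  have h1 := one_add_mul_self_le_rpow_one_add (s := Real.exp (-(u * y)) - 1)
    (by linarith [Real.exp_pos (-(u * y))]) hc
  rw [add_sub_cancel, ← Real.exp_mul] at h1
  rw [show -(c * u * y) = -(u * y) * c by ring]
  linarith

/-! ### The mass distribution function -/

/-- The mass `∫_{(0,x]} y m(dy)` of the clusters of size at most `x`. -/
noncomputable def massDist (m : Measure ℝ) (x : ℝ) : ℝ := ∫ y in Ioc 0 x, y ∂m

/-- The measure `y m(dy)` on `(0, ∞)`. -/
noncomputable def massMeasure (m : Measure ℝ) : Measure ℝ :=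
  m.withDensity fun y => ENNReal.ofReal y

instance : SFinite (massMeasure m) := by unfold massMeasure; infer_instance

theorem massMeasure_Ioc (z : ℝ) :
    massMeasure m (Ioc 0 z) ≠ ⊤ ∧ (massMeasure m).real (Ioc 0 z) = massDist m z := by
  have hi : IntegrableOn (fun y : ℝ => y) (Ioc 0 z) m := by
    refine Integrable.of_bound (by fun_prop) z ?_
    filter_upwards [ae_restrict_mem measurableSet_Ioc] with y hy
    rw [Real.norm_of_nonneg hy.1.le]
    exact hy.2
  have h0 : 0 ≤ᵐ[m.restrict (Ioc 0 z)] fun y : ℝ => y := by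
    filter_upwards [ae_restrict_mem measurableSet_Ioc] with y hy using hy.1.le
  have h1 : massMeasure m (Ioc 0 z) = ENNReal.ofReal (massDist m z) := by
    rw [massMeasure, withDensity_apply _ measurableSet_Ioc, massDist,
      ofReal_integral_eq_lintegral_ofReal hi h0]
  have h2 : 0 ≤ massDist m z := integral_nonneg_of_ae h0
  exact ⟨by rw [h1]; exact ENNReal.ofReal_ne_top, by
    rw [measureReal_def, h1, ENNReal.toReal_ofReal h2]⟩

theorem massDist_nonneg (z : ℝ) : 0 ≤ massDist m z := by
  rw [← (massMeasure_Ioc z).2]; exact measureReal_nonneg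

theorem massDist_mono : Monotone (massDist m) := by
  intro a b hab
  rw [← (massMeasure_Ioc a).2, ← (massMeasure_Ioc b).2]
  exact measureReal_mono (Ioc_subset_Ioc_right hab) (massMeasure_Ioc b).1

omit [IsFiniteMeasure m] in
theorem setIntegral_massMeasure (f : ℝ → ℝ) :
    ∫ y in Ioi 0, f y ∂(massMeasure m) = ∫ y in Ioi 0, y * f y ∂m := by
  rw [massMeasure, setIntegral_withDensity_eq_setIntegral_toReal_smul (by fun_prop) (by simp) _
    measurableSet_Ioi]
  refine setIntegral_congr_fun measurableSet_Ioi fun y hy => ?_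
  simp [ENNReal.toReal_ofReal (mem_Ioi.1 hy).le]

omit [IsFiniteMeasure m] in
theorem integrableOn_massMeasure {f : ℝ → ℝ} (h : IntegrableOn (fun y => y * f y) (Ioi 0) m) :
    IntegrableOn f (Ioi 0) (massMeasure m) := by
  rw [IntegrableOn, massMeasure, restrict_withDensity measurableSet_Ioi,
    integrable_withDensity_iff_integrable_smul' (by fun_prop) (by simp)]
  refine IntegrableOn.congr_fun h (fun y hy => ?_) measurableSet_Ioi
  simp [ENNReal.toReal_ofReal (mem_Ioi.1 hy).le]

theorem integral_exp_mul_massDist {s x : ℝ} (hs : 0 < s) (hx : 0 < x) :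
    ∫ z in Ioi 0, Real.exp (-(s * z)) * massDist m (x * z) = massTransform m (s / x) / s := by
  have h1 := integral_comp_mul_left_Ioi
    (fun z => Real.exp (-(s / x * z)) * massDist m z) 0 hx
  have h2 := integral_exp_mul_measureReal_Ioc (ω := massMeasure m) (fun z => (massMeasure_Ioc z).1)
    (div_pos hs hx)
  simp only [(massMeasure_Ioc _).2] at h2
  rw [mul_zero, h2, setIntegral_massMeasure] at h1
  rw [massTransform]
  convert h1 using 1
  · refine integral_congr_ae (Eventually.of_forall fun z => ?_)
    simp only
    congr 3
    field_simp
  · generalize ∫ y in Ioi 0, y * Real.exp (-(s / x * y)) ∂m = I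
    rw [smul_eq_mul]
    field_simp

theorem integrableOn_exp_mul_massDist {s x : ℝ} (hs : 0 < s) (hx : 0 < x) :
    IntegrableOn (fun z => Real.exp (-(s * z)) * massDist m (x * z)) (Ioi 0) := by
  have h2 := integrableOn_exp_mul_measureReal_Ioc (ω := massMeasure m)
    (fun z => (massMeasure_Ioc z).1) (div_pos hs hx)
    (integrableOn_massMeasure (integrableOn_mul_exp_neg_mul (div_pos hs hx)))
  simp only [(massMeasure_Ioc _).2] at h2
  have h1 := (integrableOn_Ioi_comp_mul_left_iff
    (fun z => Real.exp (-(s / x * z)) * massDist m z) 0 hx).2 (by rwa [mul_zero])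
  refine h1.congr_fun (fun z _ => ?_) measurableSet_Ioi
  simp only
  congr 3
  field_simp

/-- The kernel `k(z) = (1 - e^{-z} - z e^{-z}) / z²`, minus the derivative of `(1 - e^{-z}) / z`.
It expresses the Bernstein transform through the mass distribution function. -/
noncomputable def massKernel (z : ℝ) : ℝ := (1 - Real.exp (-z) - z * Real.exp (-z)) / z ^ 2

theorem measurable_massKernel : Measurable massKernel := by unfold massKernel; fun_prop

theorem massKernel_nonneg (z : ℝ) : 0 ≤ massKernel z := by
  refine div_nonneg ?_ (sq_nonneg z)
  have h1 : (z + 1) * Real.exp (-z) ≤ Real.exp z * Real.exp (-z) :=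
    mul_le_mul_of_nonneg_right (Real.add_one_le_exp z) (Real.exp_pos _).le
  rw [← Real.exp_add, add_neg_cancel, Real.exp_zero] at h1
  linarith

theorem massKernel_pos {z : ℝ} (hz : 0 < z) : 0 < massKernel z := by
  refine div_pos ?_ (by positivity)
  have h1 : (z + 1) * Real.exp (-z) < Real.exp z * Real.exp (-z) :=
    mul_lt_mul_of_pos_right (Real.add_one_lt_exp hz.ne') (Real.exp_pos _)
  rw [← Real.exp_add, add_neg_cancel, Real.exp_zero] at h1
  linarith

theorem massKernel_le_one {z : ℝ} (hz : 0 < z) : massKernel z ≤ 1 := by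
  rw [massKernel, div_le_one (by positivity)]
  nlinarith [Real.add_one_le_exp (-z)]

theorem massKernel_le_inv_sq {z : ℝ} (hz : 0 < z) : massKernel z ≤ 1 / z ^ 2 := by
  refine div_le_div_of_nonneg_right ?_ (by positivity)
  have := mul_pos hz (Real.exp_pos (-z))
  linarith [Real.exp_pos (-z)]

theorem integral_massKernel_Ioi {y : ℝ} (hy : 0 < y) :
    IntegrableOn massKernel (Ioi y) ∧ ∫ z in Ioi y, massKernel z = (1 - Real.exp (-y)) / y := by
  have hd : ∀ z ∈ Ici y, HasDerivAt (fun z => -((1 - Real.exp (-z)) / z)) (massKernel z) z := by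
    intro z hz
    have hz0 : z ≠ 0 := (lt_of_lt_of_le hy hz).ne'
    have h1 : HasDerivAt (fun z => 1 - Real.exp (-z)) (Real.exp (-z)) z := by
      simpa using ((hasDerivAt_neg z).exp).const_sub 1
    refine ((h1.div (hasDerivAt_id z) hz0).neg).congr_deriv ?_
    simp only [massKernel, id]
    field_simp
    ring
  have hlim : Tendsto (fun z : ℝ => -((1 - Real.exp (-z)) / z)) atTop (𝓝 0) := by
    have := ((Real.tendsto_exp_neg_atTop_nhds_zero.const_sub 1).div_atTop tendsto_id).neg
    simpa using this
  refine ⟨integrableOn_Ioi_deriv_of_nonneg' hd (fun z _ => massKernel_nonneg z) hlim, ?_⟩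
  rw [integral_Ioi_of_hasDerivAt_of_nonneg' hd (fun z _ => massKernel_nonneg z) hlim]
  ring

theorem integral_massKernel_mul_massDist {x : ℝ} (hx : 0 < x) :
    ∫ z in Ioi 0, massKernel z * massDist m (x * z) = x * bernsteinTransform m (1 / x) := by
  have h1 := integral_comp_mul_left_Ioi
    (fun z => massKernel (x⁻¹ * z) * massDist m z) 0 hx
  have h2 := integral_mul_measureReal_Ioc (ω := massMeasure m) (K := fun z => massKernel (x⁻¹ * z))
    (J := fun y => x ^ 2 * ((1 - Real.exp (-(1 / x * y))) / y)) (fun z => (massMeasure_Ioc z).1)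
    (measurable_massKernel.comp (by fun_prop)) (by fun_prop) (fun z _ => massKernel_nonneg _) ?_
  · simp only [(massMeasure_Ioc _).2] at h2
    rw [mul_zero, h2, setIntegral_massMeasure] at h1
    have h3 : ∀ z : ℝ, x⁻¹ * (x * z) = z := fun z => by field_simp
    simp only [h3] at h1
    rw [h1, bernsteinTransform, smul_eq_mul, ← integral_const_mul, ← integral_const_mul]
    refine setIntegral_congr_fun measurableSet_Ioi fun y hy => ?_
    have hy0 : y ≠ 0 := (mem_Ioi.1 hy).ne'
    field_simp
  · intro y hy
    have hy' : 0 < x⁻¹ * y := by positivity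
    refine ⟨(integrableOn_Ioi_comp_mul_left_iff massKernel y (inv_pos.2 hx)).2
      (integral_massKernel_Ioi hy').1, ?_⟩
    rw [integral_comp_mul_left_Ioi massKernel y (inv_pos.2 hx), (integral_massKernel_Ioi hy').2,
      one_div, smul_eq_mul, inv_inv]
    field_simp

end

/-! ### Regular variation of the Bernstein transform -/

/-- `h` is regularly varying at `0` with index `ρ`. -/
def IsRegularlyVaryingAtZero (h : ℝ → ℝ) (ρ : ℝ) : Prop :=
  ∀ c, 0 < c → Tendsto (fun x => h (c / x) / h (1 / x)) atTop (𝓝 (c ^ ρ))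

theorem tendsto_slope_rpow (ρ : ℝ) :
    Tendsto (fun c : ℝ => (c ^ ρ - 1) / (c - 1)) (𝓝[≠] 1) (𝓝 ρ) := by
  have h := hasDerivAt_iff_tendsto_slope.1
    (Real.hasDerivAt_rpow_const (x := 1) (p := ρ) (Or.inl one_ne_zero))
  simp only [Real.one_rpow, mul_one] at h
  refine h.congr fun c => ?_
  rw [slope_def_field, Real.one_rpow]

/-- A pointwise limit of quotients `h (c / x) / h (1 / x)` is multiplicative in `c`; if it is
continuous, it is a power. -/
theorem exists_eq_rpow_of_tendsto {h ψ : ℝ → ℝ} (hpos : ∀ u, 0 < u → 0 < h u)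
    (hψc : ContinuousOn ψ (Ioi 0)) (hψ0 : ∀ c, 0 < c → 0 < ψ c)
    (hlim : ∀ c, 0 < c → Tendsto (fun x => h (c / x) / h (1 / x)) atTop (𝓝 (ψ c))) :
    ∃ ρ : ℝ, ∀ c, 0 < c → ψ c = c ^ ρ := by
  have hmul : ∀ c d, 0 < c → 0 < d → ψ (c * d) = ψ c * ψ d := by
    intro c d hc hd
    have h1 : Tendsto (fun x : ℝ => x / d) atTop atTop := tendsto_id.atTop_div_const hd
    have h2 := ((hlim c hc).comp h1).mul (hlim d hd)
    refine tendsto_nhds_unique (hlim (c * d) (mul_pos hc hd)) (h2.congr' ?_)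
    filter_upwards [eventually_gt_atTop 0] with x hx
    have h3 : h (d / x) ≠ 0 := (hpos _ (div_pos hd hx)).ne'
    simp only [Function.comp]
    rw [show c / (x / d) = c * d / x by field_simp, show 1 / (x / d) = d / x by field_simp,
      div_mul_div_cancel₀ h3]
  let f : ℝ →+ ℝ := AddMonoidHom.mk' (fun u => Real.log (ψ (Real.exp u))) fun a b => by
    rw [Real.exp_add, hmul _ _ (Real.exp_pos _) (Real.exp_pos _),
      Real.log_mul (hψ0 _ (Real.exp_pos _)).ne' (hψ0 _ (Real.exp_pos _)).ne']
  have hf : Continuous f := by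
    have h1 : Continuous fun u => ψ (Real.exp u) :=
      hψc.comp_continuous Real.continuous_exp fun u => Real.exp_pos u
    exact h1.log fun u => (hψ0 _ (Real.exp_pos _)).ne'
  refine ⟨f 1, fun c hc => ?_⟩
  have h1 := map_real_smul f hf (Real.log c) 1
  have h2 : f (Real.log c) = Real.log (ψ c) := by
    change Real.log (ψ (Real.exp (Real.log c))) = _
    rw [Real.exp_log hc]
  rw [smul_eq_mul, mul_one, h2, smul_eq_mul] at h1
  rw [Real.rpow_def_of_pos hc, ← h1, Real.exp_log (hψ0 c hc)]

/-- If `t * h (s / lam t)` has a continuous strictly increasing limit `Φ s`, inserting the times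
`t = Φ 1 / h (1 / x)` shows that `lam t / x → 1`, and so that the quotients of `h` converge. -/
theorem tendsto_quotient_of_tendsto_scaled {h Φ lam : ℝ → ℝ} (hmono : StrictMonoOn h (Ici 0))
    (h0 : h 0 = 0) (hcont : ContinuousWithinAt h (Ici 0) 0) (hlam : Tendsto lam atTop atTop)
    (hΦc : ContinuousOn Φ (Ioi 0)) (hΦm : StrictMonoOn Φ (Ioi 0)) (hΦ0 : ∀ s, 0 < s → 0 < Φ s)
    (hlim : ∀ s, 0 < s → Tendsto (fun t => t * h (s / lam t)) atTop (𝓝 (Φ s)))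
    {c : ℝ} (hc : 0 < c) :
    Tendsto (fun x => h (c / x) / h (1 / x)) atTop (𝓝 (Φ c / Φ 1)) := by
  have hpos : ∀ u, 0 < u → 0 < h u := fun u hu => by
    have := hmono self_mem_Ici (mem_Ici.2 hu.le) hu
    rwa [h0] at this
  have hΦ1 := hΦ0 1 one_pos
  set T : ℝ → ℝ := fun x => Φ 1 / h (1 / x) with hT
  have hTpos : ∀ x, 0 < x → 0 < T x := fun x hx => div_pos hΦ1 (hpos _ (by positivity))
  have hTlim : Tendsto T atTop atTop := by
    have h1 : Tendsto (fun x : ℝ => 1 / x) atTop (𝓝[≥] 0) := by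
      refine tendsto_nhdsWithin_iff.2 ⟨?_, ?_⟩
      · simpa using tendsto_inv_atTop_zero (𝕜 := ℝ)
      · filter_upwards [eventually_gt_atTop 0] with x hx
        exact mem_Ici.2 (by positivity)
    have h2 : Tendsto (fun x : ℝ => h (1 / x)) atTop (𝓝[>] 0) := by
      refine tendsto_nhdsWithin_iff.2 ⟨?_, ?_⟩
      · have := hcont.tendsto.comp h1
        rwa [h0] at this
      · filter_upwards [eventually_gt_atTop 0] with x hx
        exact hpos _ (by positivity)
    have := h2.inv_tendsto_nhdsGT_zero.const_mul_atTop hΦ1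
    exact this
  have hlim' : ∀ s, 0 < s → Tendsto (fun x => T x * h (s / lam (T x))) atTop (𝓝 (Φ s)) :=
    fun s hs => (hlim s hs).comp hTlim
  have hlampos : ∀ᶠ x in atTop, 0 < lam (T x) := hTlim.eventually (hlam.eventually_gt_atTop 0)
  have hlow : ∀ s, 0 < s → s < 1 → ∀ᶠ x in atTop, s / lam (T x) < 1 / x := by
    intro s hs hs1
    filter_upwards [(hlim' s hs).eventually_lt_const (hΦm hs (mem_Ioi.2 one_pos) hs1),
      hlampos, eventually_gt_atTop 0] with x hx hl hx0
    have h1 : T x * h (1 / x) = Φ 1 := div_mul_cancel₀ _ (hpos _ (by positivity)).ne'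
    rw [← h1] at hx
    exact (hmono.lt_iff_lt (mem_Ici.2 (by positivity)) (mem_Ici.2 (by positivity))).1
      (lt_of_mul_lt_mul_left hx (hTpos x hx0).le)
  have hupp : ∀ s, 1 < s → ∀ᶠ x in atTop, 1 / x < s / lam (T x) := by
    intro s hs1
    have hs : 0 < s := one_pos.trans hs1
    filter_upwards [(hlim' s hs).eventually_const_lt (hΦm (mem_Ioi.2 one_pos) hs hs1),
      hlampos, eventually_gt_atTop 0] with x hx hl hx0
    have h1 : T x * h (1 / x) = Φ 1 := div_mul_cancel₀ _ (hpos _ (by positivity)).ne'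
    rw [← h1] at hx
    exact (hmono.lt_iff_lt (mem_Ici.2 (by positivity)) (mem_Ici.2 (by positivity))).1
      (lt_of_mul_lt_mul_left hx (hTpos x hx0).le)
  have hmain : Tendsto (fun x => T x * h (c / x)) atTop (𝓝 (Φ c)) := by
    have hcs : ContinuousAt (fun s => Φ (c * s)) 1 := by
      refine ContinuousAt.comp (g := Φ) (f := fun s => c * s) ?_ (by fun_prop)
      rw [mul_one]
      exact hΦc.continuousAt (Ioi_mem_nhds hc)
    have hcs1 : Tendsto (fun s => Φ (c * s)) (𝓝 1) (𝓝 (Φ c)) := by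
      have := hcs.tendsto
      rwa [mul_one] at this
    rw [tendsto_order]
    constructor
    · intro b hb
      obtain ⟨s, ⟨hs0, hs1⟩, hbs⟩ : ∃ s, (0 < s ∧ s < 1) ∧ b < Φ (c * s) := by
        have h1 : ∀ᶠ s in 𝓝[<] (1 : ℝ), b < Φ (c * s) :=
          (hcs1.mono_left nhdsWithin_le_nhds).eventually_const_lt hb
        exact ((Filter.Eventually.and (Ioo_mem_nhdsLT one_pos) h1).exists)
      filter_upwards [(hlim' (c * s) (by positivity)).eventually_const_lt hbs, hlow s hs0 hs1,
        hlampos, eventually_gt_atTop 0] with x hx hlx hl hx0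
      refine hx.trans_le (mul_le_mul_of_nonneg_left ?_ (hTpos x hx0).le)
      refine hmono.monotoneOn (mem_Ici.2 (by positivity)) (mem_Ici.2 (by positivity)) ?_
      rw [mul_div_assoc, div_eq_mul_one_div c x]
      exact mul_le_mul_of_nonneg_left hlx.le hc.le
    · intro b hb
      obtain ⟨s, hs1, hbs⟩ : ∃ s, 1 < s ∧ Φ (c * s) < b := by
        have h1 : ∀ᶠ s in 𝓝[>] (1 : ℝ), Φ (c * s) < b :=
          (hcs1.mono_left nhdsWithin_le_nhds).eventually_lt_const hb
        exact ((eventually_mem_nhdsWithin.and h1).exists)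
      have hs0 : 0 < s := one_pos.trans hs1
      filter_upwards [(hlim' (c * s) (by positivity)).eventually_lt_const hbs, hupp s hs1,
        hlampos, eventually_gt_atTop 0] with x hx hlx hl hx0
      refine (mul_le_mul_of_nonneg_left ?_ (hTpos x hx0).le).trans_lt hx
      refine hmono.monotoneOn (mem_Ici.2 (by positivity)) (mem_Ici.2 (by positivity)) ?_
      rw [mul_div_assoc, div_eq_mul_one_div c x]
      exact mul_le_mul_of_nonneg_left hlx.le hc.le
  refine (hmain.div_const (Φ 1)).congr fun x => ?_
  simp only [hT]
  field_simp

section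
variable {m : Measure ℝ} [IsFiniteMeasure m] {ρ : ℝ}

/-- Monotone density: regular variation passes from the concave function `bernsteinTransform m` to
its derivative. -/
theorem tendsto_massTransform_div (hm : m (Ioi 0) ≠ 0)
    (hrv : IsRegularlyVaryingAtZero (bernsteinTransform m) ρ) :
    Tendsto (fun x => 1 / x * massTransform m (1 / x) / bernsteinTransform m (1 / x)) atTop
      (𝓝 ρ) := by
  -- dividing by `c - 1` bounds the quotient from below for `c > 1` and from above for `c < 1`
  have key : ∀ c : ℝ, 0 < c → ∀ x : ℝ, 0 < x →
      bernsteinTransform m (c / x) / bernsteinTransform m (1 / x) - 1 ≤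
      (c - 1) * (1 / x * massTransform m (1 / x) / bernsteinTransform m (1 / x)) := by
    intro c hc x hx
    have hp := bernsteinTransform_pos hm (s := 1 / x) (by positivity)
    have h1 := bernsteinTransform_sub_le (m := m) (u := 1 / x) hc (by positivity)
    rw [mul_one_div] at h1
    rw [← mul_div_assoc, div_sub_one hp.ne']
    exact div_le_div_of_nonneg_right h1 hp.le
  rw [tendsto_order]
  constructor
  · intro a ha
    obtain ⟨c, hc1, hac⟩ : ∃ c : ℝ, 1 < c ∧ a < (c ^ ρ - 1) / (c - 1) := by
      have h1 := ((tendsto_slope_rpow ρ).mono_left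
        (nhdsWithin_mono (s := Ioi 1) 1 fun c hc => (mem_Ioi.1 hc).ne')).eventually_const_lt ha
      exact ((eventually_mem_nhdsWithin.and h1).exists)
    have h2 := (((hrv c (one_pos.trans hc1)).sub_const 1).div_const (c - 1)).eventually_const_lt hac
    filter_upwards [h2, eventually_gt_atTop 0] with x hx hx0
    refine hx.trans_le ?_
    rw [div_le_iff₀ (sub_pos.2 hc1), mul_comm]
    exact key c (one_pos.trans hc1) x hx0
  · intro a ha
    obtain ⟨c, ⟨hc0, hc1⟩, hac⟩ : ∃ c : ℝ, (0 < c ∧ c < 1) ∧ (c ^ ρ - 1) / (c - 1) < a := by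
      have h1 := ((tendsto_slope_rpow ρ).mono_left
        (nhdsWithin_mono (s := Iio 1) 1 fun c hc => (mem_Iio.1 hc).ne)).eventually_lt_const ha
      exact ((Filter.Eventually.and (Ioo_mem_nhdsLT one_pos) h1).exists)
    have h2 := (((hrv c hc0).sub_const 1).div_const (c - 1)).eventually_lt_const hac
    filter_upwards [h2, eventually_gt_atTop 0] with x hx hx0
    refine lt_of_le_of_lt ?_ hx
    rw [le_div_iff_of_neg (sub_neg.2 hc1), mul_comm]
    exact key c hc0 x hx0

theorem tendsto_massDist_div (hm : m (Ioi 0) ≠ 0) (hρ1 : ρ ≤ 1)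
    (hrv : IsRegularlyVaryingAtZero (bernsteinTransform m) ρ) {y : ℝ} (hy : 0 < y) :
    Tendsto (fun x => massDist m (x * y) / (x * bernsteinTransform m (1 / x))) atTop
      (𝓝 (ρ / Real.Gamma (2 - ρ) * y ^ (1 - ρ))) := by
  have hb : ∀ x : ℝ, 0 < x → 0 < bernsteinTransform m (1 / x) := fun x hx =>
    bernsteinTransform_pos hm (by positivity)
  have hpow : ∀ s : ℝ, 0 < s → IntegrableOn (fun y : ℝ => Real.exp (-(s * y)) *
      (ρ / Real.Gamma (2 - ρ) * y ^ (1 - ρ))) (Ioi 0) := by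
    intro s hs
    have h1 := integrableOn_rpow_mul_exp_neg_mul_rpow (s := 1 - ρ) (p := 1) (b := s)
      (by linarith) one_pos hs
    refine IntegrableOn.congr_fun (h1.const_mul (ρ / Real.Gamma (2 - ρ))) (fun y _ => ?_)
      measurableSet_Ioi
    simp only [Real.rpow_one, neg_mul]
    ring
  have hpowint : ∀ s : ℝ, 0 < s → ∫ y in Ioi 0, Real.exp (-(s * y)) *
      (ρ / Real.Gamma (2 - ρ) * y ^ (1 - ρ)) = ρ * s ^ ρ / s ^ 2 := by
    intro s hs
    have h1 := Real.integral_rpow_mul_exp_neg_mul_Ioi (a := 2 - ρ) (r := s) (by linarith) hs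
    have hg : Real.Gamma (2 - ρ) ≠ 0 := (Real.Gamma_pos_of_pos (by linarith)).ne'
    have h2 : ∫ y in Ioi 0, Real.exp (-(s * y)) * (ρ / Real.Gamma (2 - ρ) * y ^ (1 - ρ)) =
        ρ / Real.Gamma (2 - ρ) * ∫ t in Ioi 0, t ^ (2 - ρ - 1) * Real.exp (-(s * t)) := by
      rw [← integral_const_mul]
      refine integral_congr_ae (Eventually.of_forall fun y => ?_)
      simp only
      rw [show 2 - ρ - 1 = 1 - ρ by ring]
      ring
    rw [h2, h1, one_div, Real.inv_rpow hs.le, ← Real.rpow_neg hs.le, neg_sub,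
      Real.rpow_sub hs, Real.rpow_two]
    field_simp
  refine tendsto_of_tendsto_laplace (F := fun y => ρ / Real.Gamma (2 - ρ) * y ^ (1 - ρ))
    (G := fun x y => massDist m (x * y) / (x * bernsteinTransform m (1 / x)))
    ?_ (fun s hs => hpow s (one_pos.trans hs)) ?_ ?_ ?_ ?_ hy
  · filter_upwards [eventually_gt_atTop 0] with x hx s hs
    refine IntegrableOn.congr_fun ((integrableOn_exp_mul_massDist (m := m) (one_pos.trans hs)
      hx).div_const (x * bernsteinTransform m (1 / x))) (fun y _ => ?_) measurableSet_Ioi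
    ring
  · intro s hs
    have hs0 : 0 < s := one_pos.trans hs
    rw [hpowint s hs0]
    have h1 : Tendsto (fun x : ℝ => x / s) atTop atTop := tendsto_id.atTop_div_const hs0
    have h2 := (((tendsto_massTransform_div hm hrv).comp h1).mul (hrv s hs0)).div_const (s ^ 2)
    refine h2.congr' ?_
    filter_upwards [eventually_gt_atTop 0] with x hx
    have h3 : ∫ y in Ioi 0, Real.exp (-(s * y)) *
        (massDist m (x * y) / (x * bernsteinTransform m (1 / x))) =
        massTransform m (s / x) / s / (x * bernsteinTransform m (1 / x)) := by
      rw [← integral_exp_mul_massDist hs0 hx, ← integral_div]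
      refine integral_congr_ae (Eventually.of_forall fun y => ?_)
      simp only
      ring
    have h4 : bernsteinTransform m (s / x) ≠ 0 :=
      (bernsteinTransform_pos hm (div_pos hs0 hx)).ne'
    have h5 := (hb x hx).ne'
    rw [h3]
    simp only [Function.comp]
    rw [show 1 / (x / s) = s / x by field_simp]
    field_simp
  · filter_upwards [eventually_gt_atTop 0] with x hx a _ b _ hab
    exact div_le_div_of_nonneg_right (massDist_mono (mul_le_mul_of_nonneg_left hab hx.le))
      (mul_pos hx (hb x hx)).le
  · filter_upwards [eventually_gt_atTop 0] with x hx y _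
    exact div_nonneg (massDist_nonneg _) (mul_pos hx (hb x hx)).le
  · exact continuousOn_const.mul (continuousOn_id.rpow_const fun y hy => Or.inl (ne_of_gt hy))

/-- Regular variation of the Bernstein transform gives the mass asymptotics, with the explicit
slowly varying function `x ^ ρ * bernsteinTransform m (1 / x)`, up to a constant. -/
theorem exists_massAsymptotics (hm : m (Ioi 0) ≠ 0) (hρ0 : 0 < ρ) (hρ1 : ρ ≤ 1)
    (hrv : IsRegularlyVaryingAtZero (bernsteinTransform m) ρ) :
    ∃ L : ℝ → ℝ, IsSlowlyVarying L ∧ MassAsymptotics m ρ L := by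
  have hb : ∀ x : ℝ, 0 < x → 0 < bernsteinTransform m (1 / x) := fun x hx =>
    bernsteinTransform_pos hm (by positivity)
  have hC : 0 < ρ / Real.Gamma (2 - ρ) := div_pos hρ0 (Real.Gamma_pos_of_pos (by linarith))
  refine ⟨fun x => ρ / Real.Gamma (2 - ρ) * (x ^ ρ * bernsteinTransform m (1 / x)),
    ⟨fun x hx => ?_, fun c hc => ?_⟩, ?_⟩
  · have := hb x hx
    positivity
  · have h1 := (hrv c⁻¹ (inv_pos.2 hc)).const_mul (c ^ ρ)
    rw [Real.inv_rpow hc.le, mul_inv_cancel₀ (Real.rpow_pos_of_pos hc ρ).ne'] at h1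
    refine h1.congr' ?_
    filter_upwards [eventually_gt_atTop 0] with x hx
    have h2 := (hb x hx).ne'
    have h3 := (Real.rpow_pos_of_pos hx ρ).ne'
    have h4 := hC.ne'
    rw [Real.mul_rpow hc.le hx.le, show 1 / (c * x) = c⁻¹ / x by field_simp,
      mul_div_mul_left _ _ h4]
    field_simp
  · have h1 := (tendsto_massDist_div hm hρ1 hrv one_pos).div_const (ρ / Real.Gamma (2 - ρ))
    rw [Real.one_rpow, mul_one, div_self hC.ne'] at h1
    refine h1.congr' ?_
    filter_upwards [eventually_gt_atTop 0] with x hx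
    have h4 : x ^ (1 - ρ) * x ^ ρ = x := by
      rw [← Real.rpow_add hx, sub_add_cancel, Real.rpow_one]
    rw [mul_one, massDist]
    have h5 : x ^ (1 - ρ) * (ρ / Real.Gamma (2 - ρ) * (x ^ ρ * bernsteinTransform m (1 / x))) =
        x * bernsteinTransform m (1 / x) * (ρ / Real.Gamma (2 - ρ)) := by
      linear_combination (bernsteinTransform m (1 / x) * (ρ / Real.Gamma (2 - ρ))) * h4
    rw [h5, div_div]

end

/-! ### Laplace transforms of rescaled size distributions -/

section
variable {m : Measure ℝ} [IsFiniteMeasure m]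

theorem integral_exp_mul_measureReal_Ioc_scaled {s a : ℝ} (hs : 0 < s) (ha : 0 < a) :
    IntegrableOn (fun z => Real.exp (-(s * z)) * m.real (Ioc 0 (a * z))) (Ioi 0) ∧
    ∫ z in Ioi 0, Real.exp (-(s * z)) * m.real (Ioc 0 (a * z)) =
      (m.real (Ioi 0) - bernsteinTransform m (s / a)) / s := by
  have hsa : 0 < s / a := div_pos hs ha
  have hexp : ∀ z : ℝ, s / a * (a * z) = s * z := fun z => by field_simp
  have h0 := integrableOn_exp_mul_measureReal_Ioc (ω := m) (fun z => measure_ne_top _ _) hsa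
    (integrableOn_exp_neg_mul hsa.le)
  have h1 := (integrableOn_Ioi_comp_mul_left_iff
    (fun z => Real.exp (-(s / a * z)) * m.real (Ioc 0 z)) 0 ha).2 (by rwa [mul_zero])
  have h2 := integral_comp_mul_left_Ioi
    (fun z => Real.exp (-(s / a * z)) * m.real (Ioc 0 z)) 0 ha
  simp only [hexp] at h1 h2
  refine ⟨h1, ?_⟩
  rw [h2, mul_zero, integral_exp_mul_measureReal_Ioc (fun z => measure_ne_top _ _) hsa,
    bernsteinTransform_eq_sub hsa.le, sub_sub_cancel, smul_eq_mul]
  field_simp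

/-- The Laplace transform of the distribution function of a probability measure, at points of
`(0, ∞)`. -/
theorem integral_exp_mul_cdf (μ : Measure ℝ) [IsProbabilityMeasure μ] {s : ℝ} (hs : 0 < s) :
    ∫ z in Ioi 0, Real.exp (-(s * z)) * cdf μ z = (1 - bernsteinTransform μ s) / s := by
  have h1 := integral_exp_mul_measureReal_Ioc_scaled (m := μ) hs one_pos
  simp only [one_mul, div_one] at h1
  have h2 := integral_exp_Ioi_pos hs 0
  have hadd : μ.real (Iic 0) + μ.real (Ioi 0) = 1 := by
    rw [← measureReal_union (by simp) measurableSet_Ioi, Iic_union_Ioi, probReal_univ]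
  have h3 : ∀ z ∈ Ioi (0 : ℝ), Real.exp (-(s * z)) * cdf μ z =
      Real.exp (-(s * z)) * μ.real (Iic 0) + Real.exp (-(s * z)) * μ.real (Ioc 0 z) := by
    intro z hz
    have : μ.real (Iic z) = μ.real (Iic 0) + μ.real (Ioc 0 z) := by
      rw [← measureReal_union (by simp) measurableSet_Ioc,
        Iic_union_Ioc_eq_Iic (mem_Ioi.1 hz).le]
    rw [cdf_eq_real, this, mul_add]
  rw [setIntegral_congr_fun measurableSet_Ioi h3, integral_add (h2.1.mul_const _) h1.1,
    integral_mul_const, h2.2, h1.2]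
  simp only [mul_zero, neg_zero, Real.exp_zero]
  have : μ.real (Iic 0) = 1 - μ.real (Ioi 0) := by linarith
  rw [this]
  ring

end

namespace IsSmoluchowskiSolution

variable {ν : ℝ → Measure ℝ} (hν : IsSmoluchowskiSolution ν)
include hν

theorem isFiniteMeasure {t : ℝ} (ht : 0 ≤ t) : IsFiniteMeasure (ν t) := by
  refine ⟨?_⟩
  rw [← Iic_union_Ioi (a := (0 : ℝ))]
  refine (measure_union_le _ _).trans_lt ?_
  rw [(hν.radon t ht).null_nonpos, zero_add]
  exact hν.measure_Ioi_lt_top ht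

theorem measure_Ioi_ne_zero (hν0 : ν 0 ≠ 0) : ν 0 (Ioi 0) ≠ 0 := by
  intro h
  refine hν0 (Measure.measure_univ_eq_zero.1 ?_)
  rw [← Iic_union_Ioi (a := (0 : ℝ))]
  exact measure_union_null (hν.radon 0 le_rfl).null_nonpos h

theorem number_init_pos (hν0 : ν 0 ≠ 0) : 0 < (ν 0).real (Ioi 0) := by
  have := hν.isFiniteMeasure le_rfl
  exact ENNReal.toReal_pos (hν.measure_Ioi_ne_zero hν0) (measure_ne_top _ _)

theorem number_pos (hν0 : ν 0 ≠ 0) {t : ℝ} (ht : 0 ≤ t) : 0 < (ν t).real (Ioi 0) := by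
  rw [hν.number_eq ht]
  have := hν.number_init_pos hν0
  positivity

/-- By the explicit solution, `η_t / φ_t = t η_t + η_t / φ_0` for the total number `η` and the
Bernstein transform `φ`. -/
theorem bernsteinTransform_div_number (hν0 : ν 0 ≠ 0) {s t : ℝ} (hs : 0 < s) (ht : 0 ≤ t) :
    bernsteinTransform (ν t) s / (ν t).real (Ioi 0) =
      1 / (t * (ν t).real (Ioi 0) + (ν t).real (Ioi 0) / bernsteinTransform (ν 0) s) := by
  have := hν.isFiniteMeasure le_rfl
  have h1 := bernsteinTransform_pos (hν.measure_Ioi_ne_zero hν0) hs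
  have h2 := hν.number_pos hν0 ht
  rw [hν.bernsteinTransform_eq hs ht]
  field_simp
  ring

theorem tendsto_mul_number (hν0 : ν 0 ≠ 0) :
    Tendsto (fun t => t * (ν t).real (Ioi 0)) atTop (𝓝 1) := by
  have h0 := hν.number_init_pos hν0
  have h1 : Tendsto (fun t : ℝ => 1 + (ν 0).real (Ioi 0) * t) atTop atTop :=
    tendsto_atTop_add_const_left _ _ (tendsto_id.const_mul_atTop h0)
  have h2 := h1.inv_tendsto_atTop.const_sub 1
  rw [sub_zero] at h2
  refine h2.congr' ?_
  filter_upwards [eventually_ge_atTop 0] with t ht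
  rw [hν.number_eq ht, Pi.inv_apply]
  have : 0 < 1 + (ν 0).real (Ioi 0) * t := by positivity
  field_simp
  ring

theorem integral_exp_mul_sizeDist (hν0 : ν 0 ≠ 0) {s a t : ℝ} (hs : 0 < s) (ha : 0 < a)
    (ht : 0 ≤ t) :
    IntegrableOn (fun z => Real.exp (-(s * z)) * sizeDist ν t (a * z)) (Ioi 0) ∧
    ∫ z in Ioi 0, Real.exp (-(s * z)) * sizeDist ν t (a * z) =
      (1 - bernsteinTransform (ν t) (s / a) / (ν t).real (Ioi 0)) / s := by
  have := hν.isFiniteMeasure ht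
  have h0 := (hν.number_pos hν0 ht).ne'
  obtain ⟨h1, h2⟩ := integral_exp_mul_measureReal_Ioc_scaled (m := ν t) hs ha
  have h3 : (fun z => Real.exp (-(s * z)) * sizeDist ν t (a * z)) =
      fun z => Real.exp (-(s * z)) * (ν t).real (Ioc 0 (a * z)) / (ν t).real (Ioi 0) := by
    ext z
    rw [mul_div_assoc]
    rfl
  rw [h3]
  refine ⟨h1.div_const _, ?_⟩
  rw [integral_div, h2]
  field_simp

theorem sizeDist_mono {t : ℝ} (ht : 0 ≤ t) : Monotone (sizeDist ν t) := by
  have := hν.isFiniteMeasure ht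
  intro a b hab
  exact div_le_div_of_nonneg_right (measureReal_mono (μ := ν t) (Ioc_subset_Ioc_right hab))
    measureReal_nonneg

omit hν in
theorem sizeDist_nonneg (t x : ℝ) : 0 ≤ sizeDist ν t x :=
  div_nonneg ENNReal.toReal_nonneg ENNReal.toReal_nonneg

theorem sizeDist_le_one {t : ℝ} (ht : 0 ≤ t) (x : ℝ) : sizeDist ν t x ≤ 1 := by
  have := hν.isFiniteMeasure ht
  exact div_le_one_of_le₀ (measureReal_mono (μ := ν t) fun y hy => hy.1) measureReal_nonneg

/-! ### Convergence of the size distribution implies the mass asymptotics -/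

theorem tendsto_bernsteinTransform_div_number (hν0 : ν 0 ≠ 0) {lam : ℝ → ℝ}
    (hlam : Tendsto lam atTop atTop) {μ : Measure ℝ} [IsProbabilityMeasure μ]
    (hconv : ∀ x : ℝ, 0 < x → ContinuousAt (fun y => cdf μ y) x →
      Tendsto (fun t : ℝ => sizeDist ν t (lam t * x)) atTop (𝓝 (cdf μ x))) {s : ℝ} (hs : 0 < s) :
    Tendsto (fun t => bernsteinTransform (ν t) (s / lam t) / (ν t).real (Ioi 0)) atTop
      (𝓝 (bernsteinTransform μ s)) := by
  have h1 : Tendsto (fun t => ∫ z in Ioi 0, Real.exp (-(s * z)) * sizeDist ν t (lam t * z)) atTop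
      (𝓝 (∫ z in Ioi 0, Real.exp (-(s * z)) * cdf μ z)) := by
    refine tendsto_integral_filter_of_dominated_convergence (fun z => Real.exp (-(s * z))) ?_ ?_
      (integral_exp_Ioi_pos hs 0).1 ?_
    · filter_upwards [eventually_ge_atTop 0] with t ht
      have := (hν.sizeDist_mono ht).measurable
      fun_prop
    · filter_upwards [eventually_ge_atTop 0] with t ht
      refine Eventually.of_forall fun z => ?_
      rw [Real.norm_of_nonneg (mul_nonneg (Real.exp_pos _).le (sizeDist_nonneg _ _))]
      exact mul_le_of_le_one_right (Real.exp_pos _).le (hν.sizeDist_le_one ht _)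
    · have hc : ∀ᵐ z : ℝ, ContinuousAt (fun y => cdf μ y) z := by
        have h2 := (monotone_cdf μ).countable_not_continuousAt
        exact (h2.ae_notMem volume).mono fun z hz => by simpa using hz
      filter_upwards [ae_restrict_mem measurableSet_Ioi, ae_restrict_of_ae hc] with z hz hcz
      exact (hconv z hz hcz).const_mul _
  rw [integral_exp_mul_cdf μ hs] at h1
  have h2 := (h1.mul_const s).const_sub 1
  rw [div_mul_cancel₀ _ hs.ne', sub_sub_cancel] at h2
  refine h2.congr' ?_
  filter_upwards [eventually_ge_atTop 0, hlam.eventually_gt_atTop 0] with t ht hl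
  rw [(hν.integral_exp_mul_sizeDist hν0 hs hl ht).2, div_mul_cancel₀ _ hs.ne', sub_sub_cancel]

theorem exists_massAsymptotics_of_tendsto (hν0 : ν 0 ≠ 0) {lam : ℝ → ℝ}
    (hlam : Tendsto lam atTop atTop) {μ : Measure ℝ} [IsProbabilityMeasure μ]
    (hμ : ∃ x : ℝ, 0 < x ∧ cdf μ x < 1)
    (hconv : ∀ x : ℝ, 0 < x → ContinuousAt (fun y => cdf μ y) x →
      Tendsto (fun t : ℝ => sizeDist ν t (lam t * x)) atTop (𝓝 (cdf μ x))) :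
    ∃ ρ : ℝ, 0 < ρ ∧ ρ ≤ 1 ∧ ∃ L : ℝ → ℝ, IsSlowlyVarying L ∧ MassAsymptotics (ν 0) ρ L := by
  have := hν.isFiniteMeasure le_rfl
  have hm := hν.measure_Ioi_ne_zero hν0
  -- nontriviality of the limit: it is not the point mass at `0`
  have hμ0 : μ (Ioi 0) ≠ 0 := by
    obtain ⟨x, hx, hx1⟩ := hμ
    intro h
    have h1 : μ.real (Ioi x) = 0 := by
      rw [measureReal_def, measure_mono_null (Ioi_subset_Ioi hx.le) h, ENNReal.toReal_zero]
    have h2 : μ.real (Iic x) + μ.real (Ioi x) = 1 := by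
      rw [← measureReal_union (by simp) measurableSet_Ioi, Iic_union_Ioi, probReal_univ]
    rw [cdf_eq_real] at hx1
    linarith
  set q := bernsteinTransform μ with hq
  have hq0 : ∀ s, 0 < s → 0 < q s := fun s hs => bernsteinTransform_pos hμ0 hs
  have hq1 : ∀ s, 0 < s → q s < 1 := fun s hs =>
    (bernsteinTransform_lt hμ0 hs.le).trans_le measureReal_le_one
  -- `η_t / φ_t = t η_t + η_t / h` with `t η_t → 1` and `φ_t / η_t → q` forces
  -- `t h → 1 / (1 / q - 1)`
  set Φ : ℝ → ℝ := fun s => 1 / (1 / q s - 1) with hΦ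
  have hden : ∀ s, 0 < s → 0 < 1 / q s - 1 := fun s hs =>
    sub_pos.2 (one_lt_one_div (hq0 s hs) (hq1 s hs))
  have hΦ0 : ∀ s, 0 < s → 0 < Φ s := fun s hs => one_div_pos.2 (hden s hs)
  have hΦm : StrictMonoOn Φ (Ioi 0) := by
    intro a ha b hb hab
    refine one_div_lt_one_div_of_lt (hden b hb) (sub_lt_sub_right ?_ 1)
    exact one_div_lt_one_div_of_lt (hq0 a ha)
      (bernsteinTransform_strictMonoOn hμ0 (mem_Ici.2 (le_of_lt ha)) (mem_Ici.2 (le_of_lt hb)) hab)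
  have hΦc : ContinuousOn Φ (Ioi 0) := by
    have hqc : ContinuousOn q (Ioi 0) := bernsteinTransform_continuousOn.mono Ioi_subset_Ici_self
    exact continuousOn_const.div ((continuousOn_const.div hqc fun s hs => (hq0 s hs).ne').sub
      continuousOn_const) fun s hs => (hden s hs).ne'
  have hlim : ∀ s, 0 < s → Tendsto (fun t => t * bernsteinTransform (ν 0) (s / lam t)) atTop
      (𝓝 (Φ s)) := by
    intro s hs
    have h1 := hν.tendsto_bernsteinTransform_div_number hν0 hlam hconv hs
    have h2 := hν.tendsto_mul_number hν0
    have h3 := h2.div ((tendsto_const_nhds.div h1 (hq0 s hs).ne').sub h2) (hden s hs).ne'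
    refine h3.congr' ?_
    filter_upwards [eventually_gt_atTop 0, hlam.eventually_gt_atTop 0] with t ht hl
    have hsl : 0 < s / lam t := div_pos hs hl
    have h4 := hν.number_pos hν0 ht.le
    have h5 := bernsteinTransform_pos hm hsl
    simp only [Pi.div_apply]
    rw [hν.bernsteinTransform_div_number hν0 hsl ht.le, one_div_one_div, add_sub_cancel_left]
    field_simp
  have hquot : ∀ c, 0 < c → Tendsto (fun x => bernsteinTransform (ν 0) (c / x) /
      bernsteinTransform (ν 0) (1 / x)) atTop (𝓝 (Φ c / Φ 1)) := fun c hc =>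
    tendsto_quotient_of_tendsto_scaled (bernsteinTransform_strictMonoOn hm)
      bernsteinTransform_zero (bernsteinTransform_continuousOn 0 self_mem_Ici) hlam hΦc hΦm hΦ0
      hlim hc
  have h1 := hΦ0 1 one_pos
  obtain ⟨ρ, hρ⟩ := exists_eq_rpow_of_tendsto (fun u hu => bernsteinTransform_pos hm hu)
    (ψ := fun c => Φ c / Φ 1) (hΦc.div_const _) (fun c hc => div_pos (hΦ0 c hc) h1) hquot
  have hrv : IsRegularlyVaryingAtZero (bernsteinTransform (ν 0)) ρ := fun c hc => by
    rw [← hρ c hc]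
    exact hquot c hc
  have hρ0 : 0 < ρ := by
    have h2 : 1 < Φ 2 / Φ 1 :=
      (one_lt_div h1).2 (hΦm (mem_Ioi.2 one_pos) (mem_Ioi.2 two_pos) one_lt_two)
    rw [hρ 2 two_pos] at h2
    by_contra hle
    exact absurd h2 (not_lt.2 (Real.rpow_le_one_of_one_le_of_nonpos one_le_two (not_lt.1 hle)))
  have hρ1 : ρ ≤ 1 := by
    have h2 : (2 : ℝ) ^ ρ ≤ 2 := by
      refine le_of_tendsto (hrv 2 two_pos) ?_
      filter_upwards [eventually_gt_atTop 0] with x hx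
      rw [div_le_iff₀ (bernsteinTransform_pos hm (by positivity)), ← mul_one_div]
      exact bernsteinTransform_mul_le one_le_two (by positivity)
    nth_rewrite 2 [← Real.rpow_one 2] at h2
    exact (Real.rpow_le_rpow_left_iff one_lt_two).1 h2
  exact ⟨ρ, hρ0, hρ1, exists_massAsymptotics hm hρ0 hρ1 hrv⟩

end IsSmoluchowskiSolution

/-! ### The mass asymptotics imply regular variation -/

section
variable {m : Measure ℝ} [IsFiniteMeasure m] {ρ : ℝ} {L : ℝ → ℝ}

omit [IsFiniteMeasure m] in
theorem tendsto_massDist_quotient (hL : IsSlowlyVarying L) (hM : MassAsymptotics m ρ L) {y : ℝ}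
    (hy : 0 < y) :
    Tendsto (fun x => massDist m (x * y) / massDist m x) atTop (𝓝 (y ^ (1 - ρ))) := by
  have h1 : Tendsto (fun x => massDist m x / (x ^ (1 - ρ) * L x)) atTop (𝓝 1) := hM
  have h2 := h1.comp (tendsto_id.atTop_mul_const hy)
  have h3 := ((h2.div h1 one_ne_zero).mul (hL.2 y hy)).mul_const (y ^ (1 - ρ))
  rw [div_one, one_mul, one_mul] at h3
  refine h3.congr' ?_
  filter_upwards [eventually_gt_atTop 0] with x hx
  have h4 := (hL.1 x hx).ne'
  have h5 := (hL.1 (y * x) (mul_pos hy hx)).ne'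
  have h6 := (Real.rpow_pos_of_pos hx (1 - ρ)).ne'
  have h7 := (Real.rpow_pos_of_pos hy (1 - ρ)).ne'
  simp only [Pi.div_apply, Function.comp, id]
  rw [mul_comm x y, Real.mul_rpow hy.le hx.le]
  field_simp

theorem eventually_massDist_pos (hM : MassAsymptotics m ρ L) :
    ∀ᶠ x in atTop, 0 < massDist m x := by
  have h1 : Tendsto (fun x => massDist m x / (x ^ (1 - ρ) * L x)) atTop (𝓝 1) := hM
  filter_upwards [h1.eventually_ne one_ne_zero] with x hx
  refine lt_of_le_of_ne (massDist_nonneg x) fun h => hx ?_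
  rw [← h, zero_div]

/-- A Potter-type bound: as `M(2x) ≤ 2^a M(x)` for large `x` and `a > 1 - ρ`, the mass distribution
function grows at most like a power with exponent `a`, uniformly. -/
theorem eventually_massDist_mul_le (hL : IsSlowlyVarying L) (hM : MassAsymptotics m ρ L) {a : ℝ}
    (ha : 1 - ρ < a) (ha0 : 0 ≤ a) :
    ∀ᶠ x in atTop, ∀ z, 1 ≤ z → massDist m (x * z) ≤ 2 ^ a * z ^ a * massDist m x := by
  have h1 := (tendsto_massDist_quotient hL hM two_pos).eventually_lt_const
    (Real.rpow_lt_rpow_of_exponent_lt one_lt_two ha)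
  obtain ⟨X, hX⟩ := eventually_atTop.1
    ((h1.and (eventually_massDist_pos hM)).and (eventually_gt_atTop 0))
  filter_upwards [eventually_ge_atTop X] with x hx z hz
  have hx0 : 0 < x := (hX x hx).2
  have hdouble : ∀ n : ℕ, massDist m (x * 2 ^ n) ≤ ((2 : ℝ) ^ a) ^ n * massDist m x := by
    intro n
    induction n with
    | zero => simp
    | succ n ih =>
      have hle : x ≤ x * 2 ^ n := le_mul_of_one_le_right hx0.le (one_le_pow₀ one_le_two)
      obtain ⟨⟨h2, h3⟩, -⟩ := hX (x * 2 ^ n) (hx.trans hle)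
      rw [div_lt_iff₀ h3] at h2
      rw [pow_succ, ← mul_assoc, pow_succ]
      refine h2.le.trans ?_
      rw [mul_comm (((2 : ℝ) ^ a) ^ n), mul_assoc]
      exact mul_le_mul_of_nonneg_left ih (by positivity)
  obtain ⟨n, hn1, hn2⟩ := exists_nat_pow_near hz (one_lt_two (α := ℝ))
  calc massDist m (x * z) ≤ massDist m (x * 2 ^ (n + 1)) :=
        massDist_mono (mul_le_mul_of_nonneg_left hn2.le hx0.le)
    _ ≤ ((2 : ℝ) ^ a) ^ (n + 1) * massDist m x := hdouble (n + 1)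
    _ = 2 ^ a * ((2 : ℝ) ^ n) ^ a * massDist m x := by
        rw [pow_succ, ← Real.rpow_natCast, ← Real.rpow_mul two_pos.le, mul_comm a,
          Real.rpow_mul two_pos.le, Real.rpow_natCast]
        ring
    _ ≤ 2 ^ a * z ^ a * massDist m x := by
        refine mul_le_mul_of_nonneg_right (mul_le_mul_of_nonneg_left ?_ (by positivity))
          (massDist_nonneg x)
        exact Real.rpow_le_rpow (by positivity) hn1 ha0

/-- An Abelian theorem: the Bernstein transform at `1 / x` is asymptotic to a constant multiple of
`massDist m x / x`. The value `∫ k(z) z^{1-ρ} dz` of the constant plays no role. -/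
theorem tendsto_bernsteinTransform_div_massDist (hρ0 : 0 < ρ) (hρ1 : ρ ≤ 1)
    (hL : IsSlowlyVarying L) (hM : MassAsymptotics m ρ L) :
    ∃ C : ℝ, 0 < C ∧
      Tendsto (fun x => x * bernsteinTransform m (1 / x) / massDist m x) atTop (𝓝 C) := by
  -- any exponent in `(1 - ρ, 1)`, so that `z ^ a` is integrable against `k z ≤ 1 / z ^ 2`
  set a : ℝ := 1 - ρ / 2 with ha
  set g : ℝ → ℝ := fun z => if z ≤ 1 then 1 else 2 ^ a * z ^ (a - 2) with hg
  have hgi : IntegrableOn g (Ioi 0) := by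
    rw [← Ioc_union_Ioi_eq_Ioi zero_le_one]
    refine IntegrableOn.union ?_ ?_
    · refine IntegrableOn.congr_fun (f := fun _ => (1 : ℝ)) (by simp) (fun z hz => ?_)
        measurableSet_Ioc
      simp [hg, hz.2]
    · refine IntegrableOn.congr_fun
        ((integrableOn_Ioi_rpow_of_lt (a := a - 2) (by linarith) one_pos).const_mul (2 ^ a))
        (fun z hz => ?_) measurableSet_Ioi
      simp [hg, not_le.2 (mem_Ioi.1 hz)]
  have hkg : ∀ z, 0 < z → ∀ v, 0 ≤ v → (z ≤ 1 → v ≤ 1) → (1 ≤ z → v ≤ 2 ^ a * z ^ a) →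
      massKernel z * v ≤ g z := by
    intro z hz v hv h1 h2
    by_cases hz1 : z ≤ 1
    · simp only [hg, hz1, if_true]
      exact mul_le_one₀ (massKernel_le_one hz) hv (h1 hz1)
    · simp only [hg, hz1, if_false]
      calc massKernel z * v ≤ 1 / z ^ 2 * (2 ^ a * z ^ a) :=
            mul_le_mul (massKernel_le_inv_sq hz) (h2 (not_le.1 hz1).le) hv (by positivity)
        _ = 2 ^ a * z ^ (a - 2) := by
            rw [Real.rpow_sub hz a 2, Real.rpow_two]
            ring
  have hlimi : IntegrableOn (fun z => massKernel z * z ^ (1 - ρ)) (Ioi 0) := by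
    refine Integrable.mono' hgi ?_ ?_
    · have := measurable_massKernel
      fun_prop
    · filter_upwards [ae_restrict_mem measurableSet_Ioi] with z hz
      have hz := mem_Ioi.1 hz
      rw [Real.norm_of_nonneg (mul_nonneg (massKernel_nonneg z) (Real.rpow_nonneg hz.le _))]
      refine hkg z hz _ (Real.rpow_nonneg hz.le _)
        (fun h => Real.rpow_le_one hz.le h (by linarith)) fun h => ?_
      have h3 : z ^ (1 - ρ) ≤ z ^ a := Real.rpow_le_rpow_of_exponent_le h (by linarith)
      have h4 : (1 : ℝ) ≤ 2 ^ a := Real.one_le_rpow one_le_two (by linarith)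
      exact h3.trans (le_mul_of_one_le_left (Real.rpow_nonneg hz.le _) h4)
  refine ⟨∫ z in Ioi 0, massKernel z * z ^ (1 - ρ), ?_, ?_⟩
  · refine (setIntegral_pos_iff_support_of_nonneg_ae ?_ hlimi).2 ?_
    · filter_upwards [ae_restrict_mem measurableSet_Ioi] with z hz
      exact mul_nonneg (massKernel_nonneg z) (Real.rpow_nonneg (mem_Ioi.1 hz).le _)
    · refine lt_of_lt_of_le (b := volume (Ioi (0 : ℝ))) (by simp) (measure_mono fun z hz => ?_)
      exact ⟨(mul_pos (massKernel_pos hz) (Real.rpow_pos_of_pos hz _)).ne', hz⟩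
  · have h1 : Tendsto (fun x => ∫ z in Ioi 0, massKernel z * (massDist m (x * z) / massDist m x))
        atTop (𝓝 (∫ z in Ioi 0, massKernel z * z ^ (1 - ρ))) := by
      refine tendsto_integral_filter_of_dominated_convergence g ?_ ?_ hgi ?_
      · refine Eventually.of_forall fun x => ?_
        have h2 := measurable_massKernel
        have h3 := (massDist_mono (m := m)).measurable
        fun_prop
      · filter_upwards [eventually_massDist_pos hM, eventually_gt_atTop 0,
          eventually_massDist_mul_le hL hM (a := a) (by linarith) (by linarith)] with x hMx hx hle
        filter_upwards [ae_restrict_mem measurableSet_Ioi] with z hz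
        have hz := mem_Ioi.1 hz
        have h0 : 0 ≤ massDist m (x * z) / massDist m x :=
          div_nonneg (massDist_nonneg _) (massDist_nonneg _)
        rw [Real.norm_of_nonneg (mul_nonneg (massKernel_nonneg z) h0)]
        refine hkg z hz _ h0 (fun h => ?_) fun h => ?_
        · rw [div_le_one hMx]
          exact massDist_mono (mul_le_of_le_one_right hx.le h)
        · rw [div_le_iff₀ hMx]
          exact hle z h
      · filter_upwards [ae_restrict_mem measurableSet_Ioi] with z hz
        exact (tendsto_massDist_quotient hL hM hz).const_mul _
    refine h1.congr' ?_
    filter_upwards [eventually_gt_atTop 0] with x hx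
    rw [← integral_massKernel_mul_massDist hx, ← integral_div]
    simp only [mul_div_assoc]

theorem isRegularlyVaryingAtZero_of_massAsymptotics (hρ0 : 0 < ρ) (hρ1 : ρ ≤ 1)
    (hL : IsSlowlyVarying L) (hM : MassAsymptotics m ρ L) :
    IsRegularlyVaryingAtZero (bernsteinTransform m) ρ := by
  obtain ⟨C, hC, hlim⟩ := tendsto_bernsteinTransform_div_massDist hρ0 hρ1 hL hM
  intro c hc
  have h1 := hlim.comp (tendsto_id.atTop_div_const hc)
  have h2 := ((h1.div hlim hC.ne').mul
    (tendsto_massDist_quotient hL hM (inv_pos.2 hc))).mul_const c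
  have h3 : C / C * c⁻¹ ^ (1 - ρ) * c = c ^ ρ := by
    rw [div_self hC.ne', one_mul, Real.inv_rpow hc.le, ← Real.rpow_neg hc.le, neg_sub,
      Real.rpow_sub hc, Real.rpow_one, div_mul_cancel₀ _ hc.ne']
  rw [h3] at h2
  refine h2.congr' ?_
  filter_upwards [eventually_gt_atTop 0, eventually_massDist_pos hM,
    (tendsto_id.atTop_div_const hc).eventually (eventually_massDist_pos hM)] with x hx hMx hMc
  simp only [id] at hMc
  simp only [Pi.div_apply, Function.comp, id]
  have h4 := hMx.ne'
  have h5 := hMc.ne'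
  rw [show 1 / (x / c) = c / x by field_simp, ← div_eq_mul_inv]
  field_simp

/-- The scaling function: `1 / lam t` is the point at which the Bernstein transform equals the
total number `η₀ / (1 + η₀ t)` at time `t`. -/
theorem exists_scaling (hm : m (Ioi 0) ≠ 0) :
    ∃ lam : ℝ → ℝ, (∀ t, 0 < t → 0 < lam t) ∧ StrictMonoOn lam (Ioi 0) ∧
      Tendsto lam atTop atTop ∧ ∀ t, 0 < t →
        bernsteinTransform m (1 / lam t) = m.real (Ioi 0) / (1 + m.real (Ioi 0) * t) := by
  have hη : 0 < m.real (Ioi 0) := ENNReal.toReal_pos hm (measure_ne_top _ _)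
  have hex : ∀ t : ℝ, ∃ l : ℝ, 0 < t → 0 < l ∧
      bernsteinTransform m (1 / l) = m.real (Ioi 0) / (1 + m.real (Ioi 0) * t) := by
    intro t
    by_cases ht : 0 < t
    · set v := m.real (Ioi 0) / (1 + m.real (Ioi 0) * t) with hv
      have hv0 : 0 < v := by positivity
      have hv1 : v < m.real (Ioi 0) := div_lt_self hη (by linarith [mul_pos hη ht])
      obtain ⟨S, hS, hS0⟩ := ((tendsto_bernsteinTransform_atTop.eventually_const_lt hv1).and
        (eventually_gt_atTop 0)).exists
      obtain ⟨s, hs, hsv⟩ := intermediate_value_Icc hS0.le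
        (bernsteinTransform_continuousOn.mono Icc_subset_Ici_self)
        (show v ∈ Icc (bernsteinTransform m 0) (bernsteinTransform m S) by
          rw [bernsteinTransform_zero]; exact ⟨hv0.le, hS.le⟩)
      have hs0 : 0 < s := by
        refine lt_of_le_of_ne hs.1 fun h => hv0.ne' ?_
        rw [← hsv, ← h, bernsteinTransform_zero]
      exact ⟨1 / s, fun _ => ⟨by positivity, by rw [one_div_one_div, hsv]⟩⟩
    · exact ⟨0, fun h => absurd h ht⟩
  choose lam hlam using hex
  have hmono := bernsteinTransform_strictMonoOn hm
  refine ⟨lam, fun t ht => (hlam t ht).1, ?_, ?_, fun t ht => (hlam t ht).2⟩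
  · intro t ht t' ht' htt
    have h1 := (hlam t ht).1
    have h2 := (hlam t' ht').1
    have ht0 := mem_Ioi.1 ht
    have h3 : bernsteinTransform m (1 / lam t') < bernsteinTransform m (1 / lam t) := by
      rw [(hlam t ht).2, (hlam t' ht').2]
      refine div_lt_div_of_pos_left hη (by positivity) ?_
      linarith [mul_lt_mul_of_pos_left htt hη]
    have h4 := (hmono.lt_iff_lt (mem_Ici.2 (by positivity)) (mem_Ici.2 (by positivity))).1 h3
    exact (one_div_lt_one_div h2 h1).1 h4
  · rw [tendsto_atTop]
    intro B
    have hB : 0 < bernsteinTransform m (1 / max B 1) := bernsteinTransform_pos hm (by positivity)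
    have h1 : Tendsto (fun t : ℝ => m.real (Ioi 0) / (1 + m.real (Ioi 0) * t)) atTop (𝓝 0) :=
      tendsto_const_nhds.div_atTop
        (tendsto_atTop_add_const_left _ _ (tendsto_id.const_mul_atTop hη))
    filter_upwards [h1.eventually_lt_const hB, eventually_gt_atTop 0] with t ht ht0
    have h2 := (hlam t ht0).1
    rw [← (hlam t ht0).2] at ht
    have h4 := (hmono.lt_iff_lt (mem_Ici.2 (by positivity)) (mem_Ici.2 (by positivity))).1 ht
    exact (le_max_left B 1).trans ((one_div_lt_one_div h2 (by positivity)).1 h4).le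

end

/-! ### The Mittag-Leffler distribution function -/

/-- Compare `∫_x^∞ y^{a-1} e^{-sy} dy ≥ x^{a-1} e^{-sx} / s` with the Gamma integral. -/
theorem rpow_div_Gamma_le {a s x : ℝ} (ha : 1 ≤ a) (hs : 0 < s) (hx : 0 ≤ x) :
    x ^ (a - 1) / Real.Gamma a ≤ Real.exp (s * x) * (1 / s) ^ (a - 1) := by
  have hg : 0 < Real.Gamma a := Real.Gamma_pos_of_pos (by linarith)
  have h1 := Real.integral_rpow_mul_exp_neg_mul_Ioi (a := a) (r := s) (by linarith) hs
  have hi : IntegrableOn (fun t : ℝ => t ^ (a - 1) * Real.exp (-(s * t))) (Ioi 0) := by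
    have := integrableOn_rpow_mul_exp_neg_mul_rpow (s := a - 1) (p := 1) (b := s)
      (by linarith) one_pos hs
    simpa only [Real.rpow_one, neg_mul] using this
  have h2 : x ^ (a - 1) * (Real.exp (-(s * x)) / s) ≤ (1 / s) ^ a * Real.Gamma a := by
    rw [← h1, ← (integral_exp_Ioi_pos hs x).2, ← integral_const_mul]
    refine le_trans (setIntegral_mono_on ((integral_exp_Ioi_pos hs x).1.const_mul _)
      (hi.mono_set (Ioi_subset_Ioi hx)) measurableSet_Ioi fun t ht => ?_)
      (setIntegral_mono_set hi ?_ (Ioi_subset_Ioi hx).eventuallyLE)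
    · exact mul_le_mul_of_nonneg_right (Real.rpow_le_rpow hx (mem_Ioi.1 ht).le (by linarith))
        (Real.exp_pos _).le
    · filter_upwards [ae_restrict_mem measurableSet_Ioi] with t ht
      exact mul_nonneg (Real.rpow_nonneg (mem_Ioi.1 ht).le _) (Real.exp_pos _).le
  have h3 : (1 / s) ^ a = (1 / s) ^ (a - 1) * (1 / s) := by
    rw [← Real.rpow_add_one (by positivity), sub_add_cancel]
  rw [div_le_iff₀ hg]
  rw [h3, Real.exp_neg] at h2
  have h4 : x ^ (a - 1) = x ^ (a - 1) * ((Real.exp (s * x))⁻¹ / s) * (s * Real.exp (s * x)) := by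
    field_simp
  rw [h4]
  refine (mul_le_mul_of_nonneg_right h2 (by positivity)).trans_eq ?_
  field_simp

/-- The terms of the series that defines `mittagLefflerDist`. -/
noncomputable def mittagLefflerTerm (ρ : ℝ) (k : ℕ) (x : ℝ) : ℝ :=
  (-1 : ℝ) ^ k * x ^ (ρ * ((k : ℝ) + 1)) / Real.Gamma (1 + ρ * ((k : ℝ) + 1))

section
variable {ρ : ℝ}

theorem norm_mittagLefflerTerm (hρ : 0 < ρ) (k : ℕ) {x : ℝ} (hx : 0 ≤ x) :
    ‖mittagLefflerTerm ρ k x‖ =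
      x ^ (ρ * ((k : ℝ) + 1)) / Real.Gamma (1 + ρ * ((k : ℝ) + 1)) := by
  have hg : 0 < Real.Gamma (1 + ρ * ((k : ℝ) + 1)) := Real.Gamma_pos_of_pos (by positivity)
  rw [mittagLefflerTerm, norm_div, norm_mul, norm_pow, norm_neg, norm_one, one_pow, one_mul,
    Real.norm_of_nonneg (Real.rpow_nonneg hx _), Real.norm_of_nonneg hg.le]

theorem norm_mittagLefflerTerm_le (hρ : 0 < ρ) (k : ℕ) {s x : ℝ} (hs : 0 < s) (hx : 0 ≤ x) :
    ‖mittagLefflerTerm ρ k x‖ ≤ Real.exp (s * x) * ((1 / s) ^ ρ) ^ (k + 1) := by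
  have hk : 0 < ρ * ((k : ℝ) + 1) := by positivity
  have h := rpow_div_Gamma_le (a := 1 + ρ * ((k : ℝ) + 1)) (by linarith) hs hx
  rw [add_sub_cancel_left] at h
  rw [norm_mittagLefflerTerm hρ k hx]
  refine h.trans_eq ?_
  rw [Real.rpow_mul (by positivity), ← Nat.cast_add_one, Real.rpow_natCast]

theorem one_div_rpow_lt_one (hρ : 0 < ρ) {s : ℝ} (hs : 1 < s) : (1 / s) ^ ρ < 1 :=
  Real.rpow_lt_one (by positivity) ((div_lt_one (by linarith)).2 hs) hρ

theorem summable_one_div_rpow_pow (hρ : 0 < ρ) {s : ℝ} (hs : 1 < s) :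
    Summable fun k : ℕ => ((1 / s) ^ ρ) ^ (k + 1) :=
  (summable_nat_add_iff 1).2
    (summable_geometric_of_lt_one (by positivity) (one_div_rpow_lt_one hρ hs))

theorem continuousOn_mittagLefflerDist (hρ : 0 < ρ) :
    ContinuousOn (mittagLefflerDist ρ) (Ici 0) := by
  have hterm : ∀ k : ℕ, Continuous (mittagLefflerTerm ρ k) := fun k => by
    unfold mittagLefflerTerm
    have : 0 ≤ ρ * ((k : ℝ) + 1) := by positivity
    exact (continuous_const.mul (Real.continuous_rpow_const this)).div_const _
  intro x hx
  have hx := mem_Ici.1 hx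
  have h1 : ContinuousOn (mittagLefflerDist ρ) (Icc 0 (x + 1)) := by
    refine continuousOn_tsum (f := mittagLefflerTerm ρ) (fun k => (hterm k).continuousOn)
      ((summable_one_div_rpow_pow hρ one_lt_two).mul_left (Real.exp (2 * (x + 1))))
      fun k y hy => ?_
    refine (norm_mittagLefflerTerm_le hρ k two_pos hy.1).trans ?_
    refine mul_le_mul_of_nonneg_right (Real.exp_le_exp.2 ?_) (by positivity)
    linarith [hy.2]
  refine (h1 x ⟨hx, by linarith⟩).mono_of_mem_nhdsWithin ?_
  rw [← Ici_inter_Iic]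
  exact inter_mem_nhdsWithin _ (Iic_mem_nhds (by linarith))

theorem mittagLefflerDist_zero (hρ : 0 < ρ) : mittagLefflerDist ρ 0 = 0 := by
  have : ∀ k : ℕ, (-1 : ℝ) ^ k * 0 ^ (ρ * ((k : ℝ) + 1)) / Real.Gamma (1 + ρ * ((k : ℝ) + 1)) =
      0 := fun k => by
    rw [Real.zero_rpow (by positivity), mul_zero, zero_div]
  rw [mittagLefflerDist, tsum_congr this, tsum_zero]

theorem norm_mittagLefflerDist_le (hρ : 0 < ρ) {s x : ℝ} (hs : 1 < s) (hx : 0 ≤ x) :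
    ‖mittagLefflerDist ρ x‖ ≤ Real.exp (s * x) * ∑' k : ℕ, ((1 / s) ^ ρ) ^ (k + 1) := by
  have h := (summable_one_div_rpow_pow hρ hs).hasSum.mul_left (Real.exp (s * x))
  exact tsum_of_norm_bounded h fun k => norm_mittagLefflerTerm_le hρ k (by linarith) hx

theorem integrableOn_exp_mul_mittagLefflerDist (hρ : 0 < ρ) {s : ℝ} (hs : 1 < s) :
    IntegrableOn (fun x => Real.exp (-(s * x)) * mittagLefflerDist ρ x) (Ioi 0) := by
  obtain ⟨r, hr1, hrs⟩ := exists_between hs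
  set C : ℝ := ∑' k : ℕ, ((1 / r) ^ ρ) ^ (k + 1)
  refine Integrable.mono' (g := fun x => Real.exp (-((s - r) * x)) * C)
    ((integral_exp_Ioi_pos (sub_pos.2 hrs) 0).1.mul_const C) ?_ ?_
  · refine ContinuousOn.aestronglyMeasurable ?_ measurableSet_Ioi
    exact (by fun_prop : Continuous fun x => Real.exp (-(s * x))).continuousOn.mul
      ((continuousOn_mittagLefflerDist hρ).mono Ioi_subset_Ici_self)
  · filter_upwards [ae_restrict_mem measurableSet_Ioi] with x hx
    rw [norm_mul, Real.norm_of_nonneg (Real.exp_pos _).le]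
    refine (mul_le_mul_of_nonneg_left (norm_mittagLefflerDist_le hρ hr1 (mem_Ioi.1 hx).le)
      (Real.exp_pos _).le).trans_eq ?_
    rw [← mul_assoc, ← Real.exp_add]
    congr 2
    ring

/-- For `s > 1` the Laplace transform of the series can be computed term by term. -/
theorem integral_exp_mul_mittagLefflerDist (hρ : 0 < ρ) {s : ℝ} (hs : 1 < s) :
    ∫ x in Ioi 0, Real.exp (-(s * x)) * mittagLefflerDist ρ x = 1 / (1 + s ^ ρ) / s := by
  have hs0 : 0 < s := one_pos.trans hs
  set r : ℝ := (1 / s) ^ ρ with hr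
  have hr0 : 0 < r := by positivity
  have hr1 : r < 1 := one_div_rpow_lt_one hρ hs
  have hbase : ∀ k : ℕ, IntegrableOn (fun t : ℝ => Real.exp (-(s * t)) *
        (t ^ (ρ * ((k : ℝ) + 1)) / Real.Gamma (1 + ρ * ((k : ℝ) + 1)))) (Ioi 0) ∧
      ∫ t in Ioi 0, Real.exp (-(s * t)) *
        (t ^ (ρ * ((k : ℝ) + 1)) / Real.Gamma (1 + ρ * ((k : ℝ) + 1))) = 1 / s * r ^ (k + 1) := by
    intro k
    have hk : 0 < ρ * ((k : ℝ) + 1) := by positivity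
    have hg : Real.Gamma (1 + ρ * ((k : ℝ) + 1)) ≠ 0 :=
      (Real.Gamma_pos_of_pos (by positivity)).ne'
    have h1 := Real.integral_rpow_mul_exp_neg_mul_Ioi (a := 1 + ρ * ((k : ℝ) + 1)) (r := s)
      (by linarith) hs0
    have h2 := integrableOn_rpow_mul_exp_neg_mul_rpow (s := ρ * ((k : ℝ) + 1)) (p := 1) (b := s)
      (by linarith) one_pos hs0
    simp only [Real.rpow_one, neg_mul] at h2
    rw [add_sub_cancel_left] at h1
    have h3 : (fun t : ℝ => Real.exp (-(s * t)) *
        (t ^ (ρ * ((k : ℝ) + 1)) / Real.Gamma (1 + ρ * ((k : ℝ) + 1)))) =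
        fun t => t ^ (ρ * ((k : ℝ) + 1)) * Real.exp (-(s * t)) /
          Real.Gamma (1 + ρ * ((k : ℝ) + 1)) := by
      ext t; ring
    rw [h3]
    refine ⟨h2.div_const _, ?_⟩
    rw [integral_div, h1, mul_div_cancel_right₀ _ hg, Real.rpow_add (by positivity),
      Real.rpow_one, Real.rpow_mul (by positivity), ← Nat.cast_add_one, Real.rpow_natCast]
  have hF : ∀ k : ℕ, (fun x => Real.exp (-(s * x)) * mittagLefflerTerm ρ k x) = fun x =>
      (-1 : ℝ) ^ k * (Real.exp (-(s * x)) *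
        (x ^ (ρ * ((k : ℝ) + 1)) / Real.Gamma (1 + ρ * ((k : ℝ) + 1)))) := by
    intro k
    ext x
    rw [mittagLefflerTerm]
    ring
  have hint : ∀ k : ℕ, Integrable (fun x => Real.exp (-(s * x)) * mittagLefflerTerm ρ k x)
      (volume.restrict (Ioi 0)) := fun k => by
    rw [hF k]
    exact (hbase k).1.const_mul _
  have hnorm : ∀ k : ℕ, ∫ x in Ioi 0, ‖Real.exp (-(s * x)) * mittagLefflerTerm ρ k x‖ =
      1 / s * r ^ (k + 1) := by
    intro k
    rw [← (hbase k).2]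
    refine setIntegral_congr_fun measurableSet_Ioi fun x hx => ?_
    rw [norm_mul, norm_mittagLefflerTerm hρ k (mem_Ioi.1 hx).le,
      Real.norm_of_nonneg (Real.exp_pos _).le]
  have hsum := hasSum_integral_of_summable_integral_norm hint (by
    simp only [hnorm]
    exact (summable_one_div_rpow_pow hρ hs).mul_left _)
  have hval : ∀ k : ℕ, ∫ x in Ioi 0, Real.exp (-(s * x)) * mittagLefflerTerm ρ k x =
      1 / s * r * (-r) ^ k := by
    intro k
    rw [hF k, integral_const_mul, (hbase k).2, neg_pow r k]
    ring
  simp only [hval, tsum_mul_left] at hsum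
  have hgeom := (hasSum_geometric_of_abs_lt_one (r := -r) (by
    rw [abs_neg, abs_of_pos hr0]; exact hr1)).mul_left (1 / s * r)
  have h := hsum.unique hgeom
  have hrs : r * s ^ ρ = 1 := by
    rw [hr, one_div, Real.inv_rpow hs0.le, inv_mul_cancel₀ (Real.rpow_pos_of_pos hs0 ρ).ne']
  refine h.trans ?_
  have h1 : 0 < s ^ ρ := Real.rpow_pos_of_pos hs0 ρ
  rw [sub_neg_eq_add]
  field_simp
  linarith

end

/-- A distribution function on `[0, ∞)` with Laplace transform `1 / (1 + s ^ ρ) / s` belongs to a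
probability measure on `(0, ∞)`; no mass escapes to infinity since `1 / (1 + s ^ ρ) → 1` as
`s → 0`. -/
theorem exists_measure_of_laplace {F : ℝ → ℝ} {ρ : ℝ} (hρ : 0 < ρ)
    (hc : ContinuousOn F (Ici 0)) (h0 : F 0 = 0) (hmono : MonotoneOn F (Ici 0))
    (h1 : ∀ x, 0 ≤ x → F x ≤ 1)
    (hi : ∀ s, 0 < s → ∫ x in Ioi 0, Real.exp (-(s * x)) * F x = 1 / (1 + s ^ ρ) / s) :
    ∃ μ : Measure ℝ, IsProbabilityMeasure μ ∧ μ (Iic 0) = 0 ∧ (∀ x : ℝ, 0 < x → cdf μ x = F x) ∧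
      ∀ s : ℝ, 0 ≤ s → ∫ x, Real.exp (-(s * x)) ∂μ = 1 / (1 + s ^ ρ) := by
  have hcont : Continuous fun x => F (max x 0) :=
    hc.comp_continuous (by fun_prop) fun x => mem_Ici.2 (le_max_right x 0)
  let f : StieltjesFunction ℝ :=
    { toFun := fun x => F (max x 0)
      mono' := fun a b hab => hmono (mem_Ici.2 (le_max_right a 0)) (mem_Ici.2 (le_max_right b 0))
        (max_le_max_right 0 hab)
      right_continuous' := fun x => hcont.continuousWithinAt }
  have hf : ∀ x, 0 ≤ x → f x = F x := fun x hx => by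
    change F (max x 0) = F x
    rw [max_eq_left hx]
  have hbot : Tendsto f atBot (𝓝 0) := by
    refine tendsto_const_nhds.congr' ?_
    filter_upwards [eventually_le_atBot 0] with x hx
    change 0 = F (max x 0)
    rw [max_eq_right hx, h0]
  have htop : Tendsto f atTop (𝓝 1) := by
    rw [tendsto_order]
    refine ⟨fun b hb => ?_, fun b hb => ?_⟩
    · obtain ⟨x, hx0, hx⟩ : ∃ x, 0 ≤ x ∧ b < F x := by
        by_contra! hle
        have h2 : ∀ s : ℝ, 0 < s → 1 / (1 + s ^ ρ) ≤ b := by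
          intro s hs
          have h3 := integral_exp_Ioi_pos hs 0
          have h4 : ∫ x in Ioi 0, Real.exp (-(s * x)) * F x ≤
              ∫ x in Ioi 0, Real.exp (-(s * x)) * b := by
            refine integral_mono_of_nonneg ?_ (h3.1.mul_const b) ?_
            · filter_upwards [ae_restrict_mem measurableSet_Ioi] with x hx
              refine mul_nonneg (Real.exp_pos _).le ?_
              rw [← h0]
              exact hmono self_mem_Ici (mem_Ici.2 (mem_Ioi.1 hx).le) (mem_Ioi.1 hx).le
            · filter_upwards [ae_restrict_mem measurableSet_Ioi] with x hx
              exact mul_le_mul_of_nonneg_left (hle x (mem_Ioi.1 hx).le) (Real.exp_pos _).le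
          rw [hi s hs, integral_mul_const, h3.2, mul_zero, neg_zero, Real.exp_zero,
            div_mul_eq_mul_div, one_mul] at h4
          exact (div_le_div_iff_of_pos_right hs).1 h4
        have h5 : Tendsto (fun s : ℝ => 1 / (1 + s ^ ρ)) (𝓝[>] 0) (𝓝 1) := by
          have h6 : ContinuousAt (fun s : ℝ => 1 / (1 + s ^ ρ)) 0 := by
            refine continuousAt_const.div (continuousAt_const.add
              (Real.continuousAt_rpow_const _ _ (Or.inr hρ.le))) ?_
            rw [Real.zero_rpow hρ.ne']
            norm_num
          have h7 := h6.tendsto.mono_left (nhdsWithin_le_nhds (s := Ioi 0))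
          rwa [Real.zero_rpow hρ.ne', add_zero, div_one] at h7
        refine absurd (le_of_tendsto h5 ?_) (not_le.2 hb)
        filter_upwards [self_mem_nhdsWithin] with s hs using h2 s hs
      filter_upwards [eventually_ge_atTop x] with y hy
      rw [hf y (hx0.trans hy)]
      exact hx.trans_le (hmono (mem_Ici.2 hx0) (mem_Ici.2 (hx0.trans hy)) hy)
    · filter_upwards [eventually_ge_atTop 0] with y hy
      rw [hf y hy]
      exact (h1 y hy).trans_lt hb
  have hcdf : cdf f.measure = f := cdf_measure_stieltjesFunction f hbot htop
  have hprob : IsProbabilityMeasure f.measure := f.isProbabilityMeasure hbot htop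
  have hIic : f.measure (Iic 0) = 0 := by
    have h2 : f.measure.real (Iic 0) = 0 := by
      rw [← cdf_eq_real, hcdf, hf 0 le_rfl, h0]
    rwa [measureReal_eq_zero_iff] at h2
  have hcdfF : ∀ x, 0 ≤ x → cdf f.measure x = F x := fun x hx => by rw [hcdf, hf x hx]
  refine ⟨f.measure, hprob, hIic, fun x hx => hcdfF x hx.le, fun s hs => ?_⟩
  rcases hs.eq_or_lt with rfl | hs
  · simp [Real.zero_rpow hρ.ne']
  · have h2 := integral_exp_mul_cdf f.measure hs
    rw [setIntegral_congr_fun measurableSet_Ioi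
      (g := fun x => Real.exp (-(s * x)) * F x) (fun x hx => by
        simp only [hcdfF x (mem_Ioi.1 hx).le]), hi s hs, bernsteinTransform_eq_sub hs.le] at h2
    have h3 : ∀ᵐ x ∂f.measure, x ∈ Ioi (0 : ℝ) := by
      rw [ae_iff]
      exact measure_mono_null (fun x (hx : ¬ 0 < x) => not_lt.1 hx) hIic
    have h4 : f.measure.real (Ioi 0) = 1 := by
      have := (prob_compl_eq_zero_iff (μ := f.measure) (measurableSet_Ioi (a := (0 : ℝ)))).1
        (by rwa [compl_Ioi])
      rw [measureReal_def, this, ENNReal.toReal_one]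
    rw [Measure.restrict_eq_self_of_ae_mem h3, h4, sub_sub_cancel] at h2
    exact ((div_left_inj' hs.ne').1 h2).symm

/-! ### The mass asymptotics imply convergence to the Mittag-Leffler distribution -/

namespace IsSmoluchowskiSolution

variable {ν : ℝ → Measure ℝ} (hν : IsSmoluchowskiSolution ν)
include hν

theorem tendsto_integral_exp_mul_sizeDist (hν0 : ν 0 ≠ 0) {ρ : ℝ}
    (hrv : IsRegularlyVaryingAtZero (bernsteinTransform (ν 0)) ρ) {lam : ℝ → ℝ}
    (hlam : Tendsto lam atTop atTop)
    (heq : ∀ t, 0 < t → bernsteinTransform (ν 0) (1 / lam t) = (ν t).real (Ioi 0))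
    {s : ℝ} (hs : 0 < s) :
    Tendsto (fun t => ∫ x in Ioi 0, Real.exp (-(s * x)) * sizeDist ν t (lam t * x)) atTop
      (𝓝 (1 / (1 + s ^ ρ) / s)) := by
  have h0 : 0 < s ^ ρ := Real.rpow_pos_of_pos hs ρ
  have h1 := ((hrv s hs).comp hlam).inv₀ h0.ne'
  have h2 := (((hν.tendsto_mul_number hν0).add h1).inv₀ (by positivity)).const_sub 1 |>.div_const s
  have h3 : 1 - (1 + (s ^ ρ)⁻¹)⁻¹ = 1 / (1 + s ^ ρ) := by field_simp; ring
  rw [h3] at h2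
  refine h2.congr' ?_
  filter_upwards [eventually_gt_atTop 0, hlam.eventually_gt_atTop 0] with t ht hl
  rw [(hν.integral_exp_mul_sizeDist hν0 hs hl ht.le).2,
    hν.bernsteinTransform_div_number hν0 (div_pos hs hl) ht.le, ← heq t ht,
    one_div (_ + _), Function.comp_apply, inv_div]

theorem tendsto_sizeDist_mittagLefflerDist (hν0 : ν 0 ≠ 0) {ρ : ℝ} (hρ0 : 0 < ρ)
    (hrv : IsRegularlyVaryingAtZero (bernsteinTransform (ν 0)) ρ) {lam : ℝ → ℝ}
    (hlam : Tendsto lam atTop atTop)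
    (heq : ∀ t, 0 < t → bernsteinTransform (ν 0) (1 / lam t) = (ν t).real (Ioi 0))
    {x : ℝ} (hx : 0 < x) :
    Tendsto (fun t => sizeDist ν t (lam t * x)) atTop (𝓝 (mittagLefflerDist ρ x)) := by
  refine tendsto_of_tendsto_laplace (G := fun t x => sizeDist ν t (lam t * x)) ?_
    (fun s hs => integrableOn_exp_mul_mittagLefflerDist hρ0 hs) (fun s hs => ?_) ?_ ?_
    ((continuousOn_mittagLefflerDist hρ0).mono Ioi_subset_Ici_self) hx
  · filter_upwards [eventually_ge_atTop 0, hlam.eventually_gt_atTop 0] with t ht hl s hs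
    exact (hν.integral_exp_mul_sizeDist hν0 (one_pos.trans hs) hl ht).1
  · rw [integral_exp_mul_mittagLefflerDist hρ0 hs]
    exact hν.tendsto_integral_exp_mul_sizeDist hν0 hrv hlam heq (one_pos.trans hs)
  · filter_upwards [eventually_ge_atTop 0, hlam.eventually_gt_atTop 0] with t ht hl a _ b _ hab
    exact hν.sizeDist_mono ht (mul_le_mul_of_nonneg_left hab hl.le)
  · exact Eventually.of_forall fun t y _ => sizeDist_nonneg t _

/-- The Mittag-Leffler function inherits monotonicity and the bounds `0` and `1` from the size
distributions that converge to it; by dominated convergence its Laplace transform is known for all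
`s > 0`. -/
theorem exists_mittagLeffler_measure (hν0 : ν 0 ≠ 0) {ρ : ℝ} (hρ0 : 0 < ρ)
    (hrv : IsRegularlyVaryingAtZero (bernsteinTransform (ν 0)) ρ) {lam : ℝ → ℝ}
    (hlam : Tendsto lam atTop atTop)
    (heq : ∀ t, 0 < t → bernsteinTransform (ν 0) (1 / lam t) = (ν t).real (Ioi 0)) :
    ∃ μ : Measure ℝ, IsProbabilityMeasure μ ∧ μ (Iic 0) = 0 ∧
      (∀ x : ℝ, 0 < x → cdf μ x = mittagLefflerDist ρ x) ∧
      ∀ s : ℝ, 0 ≤ s → ∫ x, Real.exp (-(s * x)) ∂μ = 1 / (1 + s ^ ρ) := by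
  have hlim : ∀ x, 0 < x →
      Tendsto (fun t => sizeDist ν t (lam t * x)) atTop (𝓝 (mittagLefflerDist ρ x)) :=
    fun x hx => hν.tendsto_sizeDist_mittagLefflerDist hν0 hρ0 hrv hlam heq hx
  have h0 := mittagLefflerDist_zero hρ0
  have hnonneg : ∀ x, 0 ≤ x → 0 ≤ mittagLefflerDist ρ x := by
    intro x hx
    rcases hx.eq_or_lt with rfl | hx
    · exact h0.ge
    · exact ge_of_tendsto' (hlim x hx) fun t => sizeDist_nonneg t _
  refine exists_measure_of_laplace hρ0 (continuousOn_mittagLefflerDist hρ0) h0 ?_ ?_ ?_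
  · intro a ha b hb hab
    rcases (mem_Ici.1 ha).eq_or_lt with rfl | ha
    · rw [h0]
      exact hnonneg b hb
    · refine le_of_tendsto_of_tendsto (hlim a ha) (hlim b (ha.trans_le hab)) ?_
      filter_upwards [eventually_ge_atTop 0, hlam.eventually_gt_atTop 0] with t ht hl
      exact hν.sizeDist_mono ht (mul_le_mul_of_nonneg_left hab hl.le)
  · intro x hx
    rcases hx.eq_or_lt with rfl | hx
    · rw [h0]
      exact zero_le_one
    · refine le_of_tendsto (hlim x hx) ?_
      filter_upwards [eventually_ge_atTop 0] with t ht using hν.sizeDist_le_one ht _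
  · intro s hs
    refine tendsto_nhds_unique ?_ (hν.tendsto_integral_exp_mul_sizeDist hν0 hrv hlam heq hs)
    refine tendsto_integral_filter_of_dominated_convergence (fun z => Real.exp (-(s * z))) ?_ ?_
      (integral_exp_Ioi_pos hs 0).1 ?_
    · filter_upwards [eventually_ge_atTop 0] with t ht
      have := (hν.sizeDist_mono ht).measurable
      fun_prop
    · filter_upwards [eventually_ge_atTop 0] with t ht
      refine Eventually.of_forall fun z => ?_
      rw [Real.norm_of_nonneg (mul_nonneg (Real.exp_pos _).le (sizeDist_nonneg _ _))]
      exact mul_le_of_le_one_right (Real.exp_pos _).le (hν.sizeDist_le_one ht _)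
    · filter_upwards [ae_restrict_mem measurableSet_Ioi] with z hz
      exact (hlim z hz).const_mul _

end IsSmoluchowskiSolution

theorem mainTheorem1 (ν : ℝ → Measure ℝ) (hν : IsSmoluchowskiSolution ν) (hν0 : ν 0 ≠ 0) :
    (∀ lam : ℝ → ℝ, Tendsto lam atTop atTop →
      ∀ μ : Measure ℝ, IsProbabilityMeasure μ → μ (Iio 0) = 0 →
        (∃ x : ℝ, 0 < x ∧ cdf μ x < 1) →
        (∀ x : ℝ, 0 < x → ContinuousAt (fun y => cdf μ y) x →
          Tendsto (fun t : ℝ => sizeDist ν t (lam t * x)) atTop (𝓝 (cdf μ x))) →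
        ∃ ρ : ℝ, 0 < ρ ∧ ρ ≤ 1 ∧
          ∃ L : ℝ → ℝ, IsSlowlyVarying L ∧ MassAsymptotics (ν 0) ρ L) ∧
    (∀ ρ : ℝ, 0 < ρ → ρ ≤ 1 →
      ∀ L : ℝ → ℝ, IsSlowlyVarying L → MassAsymptotics (ν 0) ρ L →
        (∃ lam : ℝ → ℝ, (∀ t : ℝ, 0 < t → 0 < lam t) ∧ StrictMonoOn lam (Ioi 0) ∧
          Tendsto lam atTop atTop ∧
          ∀ x : ℝ, 0 < x →
            Tendsto (fun t : ℝ => sizeDist ν t (lam t * x)) atTop (𝓝 (mittagLefflerDist ρ x))) ∧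
        (∃ μ : Measure ℝ, IsProbabilityMeasure μ ∧ μ (Iic 0) = 0 ∧
          (∀ x : ℝ, 0 < x → cdf μ x = mittagLefflerDist ρ x) ∧
          ∀ s : ℝ, 0 ≤ s → ∫ x, Real.exp (-(s * x)) ∂μ = 1 / (1 + s ^ ρ))) := by
  refine ⟨fun lam hlam μ hμ _ hμ1 hconv =>
    hν.exists_massAsymptotics_of_tendsto hν0 hlam hμ1 hconv, fun ρ hρ0 hρ1 L hL hM => ?_⟩
  have := hν.isFiniteMeasure le_rfl
  have hrv := isRegularlyVaryingAtZero_of_massAsymptotics hρ0 hρ1 hL hM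
  obtain ⟨lam, hpos, hmono, hlam, heq⟩ := exists_scaling (hν.measure_Ioi_ne_zero hν0)
  have heq' : ∀ t, 0 < t → bernsteinTransform (ν 0) (1 / lam t) = (ν t).real (Ioi 0) :=
    fun t ht => by rw [heq t ht, hν.number_eq ht.le]
  exact ⟨⟨lam, hpos, hmono, hlam, fun x hx =>
    hν.tendsto_sizeDist_mittagLefflerDist hν0 hρ0 hrv hlam heq' hx⟩,
    hν.exists_mittagLeffler_measure hν0 hρ0 hrv hlam heq'⟩
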